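/- Let $n\ge 1$. A function $\varphi\in L^1_{loc}(\mathbb{R}^n)$ is in $BV_{loc}(\mathbb{R}^n)$ if its distributional partial derivatives are signed Radon measures; $\|D\varphi\|$ is the total variation of its gradient measure $D\varphi$. A path $X:[0,T]\to\mathbb{R}^n$ is called $(s,p)$-variable with respect to $\varphi$ ($0<s<1$, $1\le p\le\infty$) if there is a relatively compact open neighbourhood $\mathcal{U}$ of $X([0,T])$ such that $t\mapsto\int_{\mathcal{U}}|X_t-y|^{-(n-1+s)}\,\|D\varphi\|(dy)$ is in $L^p(0,T)$. In that case $\varphi\circ X$ denotes the class of $t\mapsto\widetilde\varphi(X_t)$, where $\widetilde\varphi$ is any Lebesgue representative of $\varphi$, i.e. a Borel function such that $\widetilde\varphi(x)$ is the approximate limit of $\varphi$ at $x$ for every $x$ at which that limit exists. Put $[X]_{\alpha,\infty}=\sup_{0\le u<t\le T}|X_t-X_u|/(t-u)^\alpha$ and $[f]_{\beta,p}^p=\int_0^T\int_0^T\frac{|f(t)-f(u)|^p}{|t-u|^{1+\beta p}}\,du\,dt$. Let $\alpha\in(0,1]$, $s\in(0,1)$, $\beta\in(0,\alpha s)$ and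 $\kappa>0$. (i) For every $p\in[1,\infty)$ there is a constant $c>0$, depending only on $\alpha,\beta,n,p,s$ and $\kappa$, with the following property. Let $T>0$, let $\varphi\in BV_{loc}(\mathbb{R}^n)$, let $X:[0,T]\to\mathbb{R}^n$ be Hölder continuous of order $\alpha$ and $(s,p)$-variable with respect to $\varphi$, and let $\mathcal{U}$ be a relatively compact open neighbourhood of $X([0,T])$ which contains every point whose distance from $X([0,T])$ is less than $\kappa\,\mathrm{diam}\,X([0,T])$. Then $$[\varphi\circ X]_{\beta,p}^p\le c\,T^{(\alpha s-\beta)p}\,[X]_{\alpha,\infty}^{sp}\int_0^T\Big(\int_{\mathcal{U}}\frac{\|D\varphi\|(dy)}{|X_t-y|^{n-1+s}}\Big)^p dt .$$ (ii) There is a constant $c>0$, depending only on $\alpha,\beta,n,s$ and $\kappa$, such that, for all $T$, $\varphi$, $X$ and $\mathcal{U}$ as in (i) but with $X$ being $(s,\infty)$-variable with respect to $\varphi$, $$\operatorname*{ess\,sup}_{t\in[0,T]}\int_0^t\frac{|\varphi(X_t)-\varphi(X_\tau)|}{(t-\tau)^{1+\beta}}\,d\tau\le c\,T^{\alpha s-\beta}\,[X]_{\alpha,\infty}^{s}\operatorname*{ess\,sup}_{t\in[0,T]}\int_{\mathcal{U}}\frac{\|D\varphi\|(dy)}{|X_t-y|^{n-1+s}}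 .$$ -/

import Mathlib

open MeasureTheory Set Filter Topology
open scoped ENNReal NNReal ContDiff

noncomputable section

/-- A signed Radon measure on `E`: a difference `pos - neg` of two positive Radon (locally finite
Borel) measures. As a set function it takes finite values on bounded Borel sets only. -/
structure SignedRadonMeasure (E : Type*) [TopologicalSpace E] [MeasurableSpace E] where
  /-- the positive measure that is added -/
  pos : Measure E
  /-- the positive measure that is subtracted -/
  neg : Measure E
  /-- `pos` is locally finite -/
  pos_locallyFinite : IsLocallyFiniteMeasure pos
  /-- `neg` is locally finite -/
  neg_locallyFinite : IsLocallyFiniteMeasure neg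

theorem isFiniteMeasure_restrict_closedBall_of_locallyFinite {n : ℕ}
    (μ : Measure (EuclideanSpace ℝ (Fin n))) (h : IsLocallyFiniteMeasure μ) (R : ℝ) :
    IsFiniteMeasure (μ.restrict (Metric.closedBall 0 R)) :=
  isFiniteMeasure_restrict.2 (isCompact_closedBall 0 R).measure_lt_top.ne

namespace SignedRadonMeasure

/-- The integral of a (compactly supported continuous) function against a signed Radon measure. -/
def integral {E : Type*} [TopologicalSpace E] [MeasurableSpace E]
    (μ : SignedRadonMeasure E) (ψ : E → ℝ) : ℝ :=
  (∫ x, ψ x ∂μ.pos) - ∫ x, ψ x ∂μ.neg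

/-- The restriction of a signed Radon measure on `ℝⁿ` to the closed ball of radius `R` about `0`,
a finite signed measure. -/
def onBall {n : ℕ} (μ : SignedRadonMeasure (EuclideanSpace ℝ (Fin n))) (R : ℝ) :
    SignedMeasure (EuclideanSpace ℝ (Fin n)) :=
  haveI := isFiniteMeasure_restrict_closedBall_of_locallyFinite μ.pos μ.pos_locallyFinite R
  haveI := isFiniteMeasure_restrict_closedBall_of_locallyFinite μ.neg μ.neg_locallyFinite R
  (μ.pos.restrict (Metric.closedBall 0 R)).toSignedMeasure -
    (μ.neg.restrict (Metric.closedBall 0 R)).toSignedMeasure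

/-- For signed Radon measures `μ₁, …, μₙ` on `ℝⁿ`, the `ℝⁿ`-valued measure `(μ₁, …, μₙ)`
restricted to the closed ball of radius `R` about `0`. -/
def vectorOnBall {n : ℕ} (μ : Fin n → SignedRadonMeasure (EuclideanSpace ℝ (Fin n))) (R : ℝ) :
    VectorMeasure (EuclideanSpace ℝ (Fin n)) (EuclideanSpace ℝ (Fin n)) :=
  ∑ i, ((μ i).onBall R).mapRange
    (ContinuousLinearMap.toSpanSingleton ℝ
      (EuclideanSpace.single i (1 : ℝ))).toLinearMap.toAddMonoidHom
    (ContinuousLinearMap.toSpanSingleton ℝ (EuclideanSpace.single i (1 : ℝ))).continuous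

/-- The total variation (with respect to the Euclidean norm) of the `ℝⁿ`-valued Radon measure
`(μ₁, …, μₙ)`, as the increasing limit of the total variations of its restrictions to balls. -/
def totalVariation {n : ℕ} (μ : Fin n → SignedRadonMeasure (EuclideanSpace ℝ (Fin n))) :
    Measure (EuclideanSpace ℝ (Fin n)) :=
  ⨆ R : ℕ, (vectorOnBall μ (R : ℝ)).variation

end SignedRadonMeasure

/-- `μ = (μ₁, …, μₙ)` is the distributional gradient of `φ`: for every test function
`ψ ∈ C_c^∞(ℝⁿ)` and every `i` one has `∫ φ ∂ᵢψ dx = - ∫ ψ dμᵢ`. -/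
def IsDistribGradient {n : ℕ} (φ : EuclideanSpace ℝ (Fin n) → ℝ)
    (μ : Fin n → SignedRadonMeasure (EuclideanSpace ℝ (Fin n))) : Prop :=
  ∀ ψ : EuclideanSpace ℝ (Fin n) → ℝ, ContDiff ℝ ∞ ψ → HasCompactSupport ψ →
    ∀ i, ∫ x, φ x * fderiv ℝ ψ x (EuclideanSpace.single i 1) = -(μ i).integral ψ

/-- `φ ∈ BV_loc(ℝⁿ)`: `φ` is locally integrable and its distributional partial derivatives are
signed Radon measures. -/
def BVLoc {n : ℕ} (φ : EuclideanSpace ℝ (Fin n) → ℝ) : Prop :=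
  LocallyIntegrable φ ∧ ∃ μ, IsDistribGradient φ μ

open Classical in
/-- The total variation measure `‖Dφ‖` of the gradient measure of `φ ∈ BV_loc(ℝⁿ)` (it does not
depend on how the signed measures `D₁φ, …, Dₙφ` are written as differences); `0` by convention
for all other `φ`. -/
def gradVariation {n : ℕ} (φ : EuclideanSpace ℝ (Fin n) → ℝ) :
    Measure (EuclideanSpace ℝ (Fin n)) :=
  if h : BVLoc φ then SignedRadonMeasure.totalVariation h.2.choose else 0

/-- `φ` has the approximate limit `l` at `x`. -/
def HasApproxLimit {n : ℕ} (φ : EuclideanSpace ℝ (Fin n) → ℝ) (x : EuclideanSpace ℝ (Fin n))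
    (l : ℝ) : Prop :=
  Tendsto (fun r : ℝ => ⨍ y in Metric.ball x r, |φ y - l|) (𝓝[>] 0) (𝓝 0)

/-- `φt` is a Lebesgue representative of `φ`: a Borel function whose value is the approximate limit
of `φ` at each point where `φ` has one. -/
def IsLebesgueRep {n : ℕ} (φ φt : EuclideanSpace ℝ (Fin n) → ℝ) : Prop :=
  Measurable φt ∧ ∀ x l, HasApproxLimit φ x l → φt x = l

/-- `U` is a relatively compact open neighbourhood of the set `K`. -/
def IsRelCompactOpenNhd {E : Type*} [TopologicalSpace E] (U K : Set E) : Prop :=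
  IsOpen U ∧ IsCompact (closure U) ∧ K ⊆ U

/-- The potential `∫_U |x - y|^{-(n-1+s)} ‖Dφ‖(dy) ∈ [0, ∞]` (the kernel is `∞` at `y = x`). -/
def gradPotential {n : ℕ} (φ : EuclideanSpace ℝ (Fin n) → ℝ) (s : ℝ)
    (U : Set (EuclideanSpace ℝ (Fin n))) (x : EuclideanSpace ℝ (Fin n)) : ℝ≥0∞ :=
  ∫⁻ y in U, ‖x - y‖ₑ ^ (-((n : ℝ) - 1 + s)) ∂gradVariation φ

/-- The path `X : [0,T] → ℝⁿ` is `(s,p)`-variable with respect to `φ`. -/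
def IsVariable {n : ℕ} (φ : EuclideanSpace ℝ (Fin n) → ℝ) (s : ℝ) (p : ℝ≥0∞) (T : ℝ)
    (X : ℝ → EuclideanSpace ℝ (Fin n)) : Prop :=
  ∃ U, IsRelCompactOpenNhd U (X '' Icc 0 T) ∧
    MemLp (fun t => gradPotential φ s U (X t)) p (volume.restrict (Ioo 0 T))

/-- The Hölder seminorm `[X]_{α,∞} ∈ [0, ∞]` of order `α` of `X` on `[0,T]`. -/
def holderSeminorm {n : ℕ} (α T : ℝ) (X : ℝ → EuclideanSpace ℝ (Fin n)) : ℝ≥0∞ :=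
  ⨆ (u : ℝ) (t : ℝ) (_ : 0 ≤ u ∧ u < t ∧ t ≤ T), ‖X t - X u‖ₑ / ENNReal.ofReal ((t - u) ^ α)

/-- `X` is Hölder continuous of order `α` on `[0,T]`. -/
def IsHolderPath {n : ℕ} (α T : ℝ) (X : ℝ → EuclideanSpace ℝ (Fin n)) : Prop :=
  holderSeminorm α T X < ⊤

/-- The Gagliardo seminorm `[f]_{θ,p} ∈ [0, ∞]` of a function on `(0,T)`. -/
def gagliardoSeminorm (θ p T : ℝ) (f : ℝ → ℝ) : ℝ≥0∞ :=
  (∫⁻ t in Ioo 0 T, ∫⁻ u in Ioo 0 T,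
    ‖f t - f u‖ₑ ^ p / ENNReal.ofReal (|t - u| ^ (1 + θ * p))) ^ (1 / p)

end

/-! Everything follows from one increment estimate in space. Write V(x) for the potential
`gradPotential φ s U x`. Then |φ̃(X_t) − φ̃(X_u)| ≤ C |X_t − X_u|^s (V(X_t) + V(X_u))
(`exists_enorm_comp_sub_le`). Hölder continuity turns the factor in space into |t − u|^(αs). After
division by the Gagliardo weight there remains |t − u|^((αs−β)p−1), which is integrable because β <
αs. This yields both (i) and, with p = 1, (ii).

For the increment estimate, V(x) < ∞ forces ‖Dφ‖(B(x,ρ) ∩ U) ≤ ρ^(n−1+s) V(x)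
(`gradVariation_ball_inter_le`). The L¹ modulus of continuity of BV functions, obtained by
mollification, implies a weak Poincaré inequality, so the mean oscillation of φ on B(x,r) is at most
a constant times r^s V(x). Summation over dyadic radii shows that φ has an approximate limit at x,
at distance at most C r^s V(x) from its average over B(x,r) (`GradBound.exists_hasApproxLimit`).

It remains to compare the averages at X_t and X_u over balls of one radius r ≤ |X_t − X_u|. Let D be
the diameter of the path. If |X_t − X_u| is small compared with D, one translation suffices.
Otherwise the segment from X_t to X_u may leave U, and the comparison follows the path itself with r
= δD: the averages vary continuously along it, change little between points within r of each other,
and only boundedly many points of the path can be r-separated (`abs_sub_le_of_card_separated_le`).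
-/

namespace SignedRadonMeasure

/-! ### Total variation of a vector of signed Radon measures -/

variable {n : ℕ}

theorem vectorOnBall_apply (μ : Fin n → SignedRadonMeasure (EuclideanSpace ℝ (Fin n))) (R : ℝ)
    (A : Set (EuclideanSpace ℝ (Fin n))) (i : Fin n) :
    vectorOnBall μ R A i = (μ i).onBall R A := by
  unfold vectorOnBall
  rw [sum_apply]
  simp [VectorMeasure.mapRange_apply, Finset.sum_apply, Pi.single_apply]

theorem variation_onBall_le (μ : Fin n → SignedRadonMeasure (EuclideanSpace ℝ (Fin n))) (R : ℝ)
    (i : Fin n) : ((μ i).onBall R).variation ≤ (vectorOnBall μ R).variation := by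
  refine VectorMeasure.variation_le_of_forall_enorm_le fun A _ => ?_
  refine le_trans ?_ (VectorMeasure.enorm_measure_le_variation _ A)
  rw [← vectorOnBall_apply, enorm_le_iff_norm_le]
  exact PiLp.norm_apply_le _ i

/-- A crude bound, needed only to make the total variation σ-finite, so that Tonelli's theorem is
available. -/
theorem totalVariation_le (μ : Fin n → SignedRadonMeasure (EuclideanSpace ℝ (Fin n))) :
    totalVariation μ ≤ ∑ i, ((μ i).pos + (μ i).neg) := by
  refine iSup_le fun R => VectorMeasure.variation_le_of_forall_enorm_le fun A hA => ?_
  have h1 : ‖vectorOnBall μ R A‖ₑ ≤ ∑ i, ‖(μ i).onBall R A‖ₑ := by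
    have : vectorOnBall μ R A = ∑ i, EuclideanSpace.single i ((μ i).onBall R A) := by
      ext j
      rw [vectorOnBall_apply]
      simp [Finset.sum_apply]
    rw [this]
    refine (enorm_sum_le _ _).trans (Finset.sum_le_sum fun i _ => ?_)
    rw [enorm_le_iff_norm_le]
    simp
  refine h1.trans ?_
  rw [Measure.finsetSum_apply]
  refine Finset.sum_le_sum fun i _ => ?_
  have := isFiniteMeasure_restrict_closedBall_of_locallyFinite (μ i).pos (μ i).pos_locallyFinite R
  have := isFiniteMeasure_restrict_closedBall_of_locallyFinite (μ i).neg (μ i).neg_locallyFinite R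
  unfold onBall
  rw [sub_apply]
  refine (enorm_sub_le).trans ?_
  rw [Measure.add_apply]
  gcongr
  · refine (VectorMeasure.enorm_measure_le_variation _ A).trans ?_
    rw [Measure.variation_toSignedMeasure]
    exact Measure.restrict_apply_le _ _
  · refine (VectorMeasure.enorm_measure_le_variation _ A).trans ?_
    rw [Measure.variation_toSignedMeasure]
    exact Measure.restrict_apply_le _ _

theorem sigmaFinite_totalVariation
    (μ : Fin n → SignedRadonMeasure (EuclideanSpace ℝ (Fin n))) :
    SigmaFinite (totalVariation μ) := by
  have : IsLocallyFiniteMeasure (∑ i, ((μ i).pos + (μ i).neg)) := by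
    refine ⟨fun x => ?_⟩
    have h : ∀ i, (((μ i).pos + (μ i).neg)).FiniteAtFilter (𝓝 x) := fun i => by
      have := (μ i).pos_locallyFinite
      have := (μ i).neg_locallyFinite
      obtain ⟨s, hs, h1⟩ := (μ i).pos.finiteAt_nhds x
      obtain ⟨t, ht, h2⟩ := (μ i).neg.finiteAt_nhds x
      refine ⟨s ∩ t, inter_mem hs ht, ?_⟩
      rw [Measure.add_apply]
      exact ENNReal.add_lt_top.2 ⟨(measure_mono inter_subset_left).trans_lt h1,
        (measure_mono inter_subset_right).trans_lt h2⟩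
    choose s hs hs' using h
    refine ⟨⋂ i, s i, (Filter.iInter_mem).2 hs, ?_⟩
    rw [Measure.finsetSum_apply]
    exact ENNReal.sum_lt_top.2 fun i _ => (measure_mono (iInter_subset _ i)).trans_lt (hs' i)
  exact Measure.sigmaFinite_of_le _ (totalVariation_le μ)

theorem integral_eq_of_support_subset (μ : SignedRadonMeasure (EuclideanSpace ℝ (Fin n)))
    {ψ : EuclideanSpace ℝ (Fin n) → ℝ} {R : ℝ}
    (hR : Function.support ψ ⊆ Metric.closedBall 0 R) :
    μ.integral ψ = ∫ x, ψ x ∂(μ.pos.restrict (Metric.closedBall 0 R))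
      - ∫ x, ψ x ∂(μ.neg.restrict (Metric.closedBall 0 R)) := by
  unfold integral
  rw [setIntegral_eq_integral_of_forall_compl_eq_zero,
    setIntegral_eq_integral_of_forall_compl_eq_zero]
  all_goals
    intro x hx
    by_contra h
    exact hx (hR h)

/-- `pos` and `neg` need not be mutually singular, so estimating their integrals separately would be
too lossy. On a ball containing the support of ψ they are replaced by the Jordan decomposition,
whose two parts add up to the variation. -/
theorem enorm_integral_le (μ : Fin n → SignedRadonMeasure (EuclideanSpace ℝ (Fin n)))
    {ψ : EuclideanSpace ℝ (Fin n) → ℝ} (hψ : Continuous ψ) (hc : HasCompactSupport ψ) (i : Fin n) :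
    ‖(μ i).integral ψ‖ₑ ≤ ∫⁻ x, ‖ψ x‖ₑ ∂(totalVariation μ) := by
  obtain ⟨R₀, hR₀⟩ := hc.isCompact.isBounded.subset_closedBall 0
  obtain ⟨R, hR⟩ := exists_nat_ge R₀
  have hsupp : Function.support ψ ⊆ Metric.closedBall 0 (R : ℝ) :=
    (subset_tsupport ψ).trans (hR₀.trans (Metric.closedBall_subset_closedBall hR))
  rw [integral_eq_of_support_subset _ hsupp]
  have := isFiniteMeasure_restrict_closedBall_of_locallyFinite (μ i).pos (μ i).pos_locallyFinite R
  have := isFiniteMeasure_restrict_closedBall_of_locallyFinite (μ i).neg (μ i).neg_locallyFinite R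
  set a := (μ i).pos.restrict (Metric.closedBall 0 (R : ℝ)) with ha
  set b := (μ i).neg.restrict (Metric.closedBall 0 (R : ℝ)) with hb
  have hν : (μ i).onBall R = a.toSignedMeasure - b.toSignedMeasure := rfl
  set j := ((μ i).onBall R).toJordanDecomposition with hj
  have hJ : j.posPart.toSignedMeasure - j.negPart.toSignedMeasure =
      a.toSignedMeasure - b.toSignedMeasure := by
    rw [← hν]
    exact SignedMeasure.toSignedMeasure_toJordanDecomposition _
  -- The equality of differences is rearranged into an equality of positive measures, against which
  -- ψ can be integrated.
  have hsum : a + j.negPart = b + j.posPart := by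
    rw [← Measure.toSignedMeasure_eq_toSignedMeasure_iff, Measure.toSignedMeasure_add,
      Measure.toSignedMeasure_add]
    have := sub_eq_sub_iff_add_eq_add.1 hJ
    rw [← this, add_comm]
  have hint : ∀ (m : Measure (EuclideanSpace ℝ (Fin n))) [IsFiniteMeasure m], Integrable ψ m :=
    fun m _ => hψ.integrable_of_hasCompactSupport hc
  have heq : ∫ x, ψ x ∂a - ∫ x, ψ x ∂b = ∫ x, ψ x ∂j.posPart - ∫ x, ψ x ∂j.negPart := by
    have := congrArg (fun m => ∫ x, ψ x ∂m) hsum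
    rw [integral_add_measure (hint _) (hint _), integral_add_measure (hint _) (hint _)] at this
    linarith
  rw [heq]
  calc ‖∫ x, ψ x ∂j.posPart - ∫ x, ψ x ∂j.negPart‖ₑ
      ≤ ‖∫ x, ψ x ∂j.posPart‖ₑ + ‖∫ x, ψ x ∂j.negPart‖ₑ := enorm_sub_le
    _ ≤ (∫⁻ x, ‖ψ x‖ₑ ∂j.posPart) + ∫⁻ x, ‖ψ x‖ₑ ∂j.negPart := by
      gcongr <;> exact enorm_integral_le_lintegral_enorm _
    _ = ∫⁻ x, ‖ψ x‖ₑ ∂((μ i).onBall R).totalVariation := by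
      rw [← lintegral_add_measure]; rfl
    _ ≤ ∫⁻ x, ‖ψ x‖ₑ ∂(totalVariation μ) := by
      refine lintegral_mono' ?_ le_rfl
      rw [SignedMeasure.totalVariation_eq_variation]
      exact (variation_onBall_le μ R i).trans (le_iSup (fun R : ℕ => (vectorOnBall μ R).variation) R)

end SignedRadonMeasure

/-- The distributional gradient of `φ` is dominated by the measure `G`. -/
def GradBound {n : ℕ} (φ : EuclideanSpace ℝ (Fin n) → ℝ)
    (G : Measure (EuclideanSpace ℝ (Fin n))) : Prop :=
  ∀ ψ : EuclideanSpace ℝ (Fin n) → ℝ, ContDiff ℝ ∞ ψ → HasCompactSupport ψ →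
    ∀ h : EuclideanSpace ℝ (Fin n),
      ‖∫ x, φ x * fderiv ℝ ψ x h‖ₑ ≤ n * ‖h‖ₑ * ∫⁻ x, ‖ψ x‖ₑ ∂G

theorem BVLoc.sigmaFinite_gradVariation {n : ℕ} {φ : EuclideanSpace ℝ (Fin n) → ℝ}
    (hφ : BVLoc φ) : SigmaFinite (gradVariation φ) := by
  rw [gradVariation, dif_pos hφ]
  exact SignedRadonMeasure.sigmaFinite_totalVariation _

/-- Expanding h in coordinates gives n terms, each at most ‖h‖ ∫ |ψ| d‖Dφ‖. The resulting factor n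
is not sharp, but only enters the constants. -/
theorem BVLoc.gradBound {n : ℕ} {φ : EuclideanSpace ℝ (Fin n) → ℝ}
    (hφ : BVLoc φ) : GradBound φ (gradVariation φ) := by
  intro ψ hψ hc h
  rw [gradVariation, dif_pos hφ]
  set μ := hφ.2.choose
  have hμ : IsDistribGradient φ μ := hφ.2.choose_spec
  have hint : ∀ v, Integrable fun x => φ x * fderiv ℝ ψ x v := fun v => by
    have h1 : Continuous fun x => fderiv ℝ ψ x v :=
      (hψ.continuous_fderiv (by simp)).clm_apply continuous_const
    have h2 : HasCompactSupport fun x => fderiv ℝ ψ x v := hc.fderiv_apply (𝕜 := ℝ) v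
    simpa [mul_comm] using hφ.1.integrable_smul_left_of_hasCompactSupport h1 h2
  have hexp : ∫ x, φ x * fderiv ℝ ψ x h = - ∑ i, h i * (μ i).integral ψ := by
    have : ∀ x, φ x * fderiv ℝ ψ x h
        = ∑ i, h i * (φ x * fderiv ℝ ψ x (EuclideanSpace.single i 1)) := fun x => by
      have hh : h = ∑ i, h i • EuclideanSpace.single i (1 : ℝ) := by
        ext j; simp [Finset.sum_apply, Pi.single_apply]
      conv_lhs => rw [hh, map_sum]
      rw [Finset.mul_sum]
      refine Finset.sum_congr rfl fun i _ => ?_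
      rw [map_smul, smul_eq_mul]; ring
    simp_rw [this]
    rw [integral_finsetSum _ fun i _ => (hint _).const_mul _]
    simp_rw [integral_const_mul, hμ ψ hψ hc]
    simp
  rw [hexp, enorm_neg]
  calc ‖∑ i, h i * (μ i).integral ψ‖ₑ ≤ ∑ i, ‖h i * (μ i).integral ψ‖ₑ := enorm_sum_le _ _
    _ ≤ ∑ _i : Fin n, ‖h‖ₑ * ∫⁻ x, ‖ψ x‖ₑ ∂(SignedRadonMeasure.totalVariation μ) := by
      refine Finset.sum_le_sum fun i _ => ?_
      rw [enorm_mul]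
      gcongr
      · rw [enorm_le_iff_norm_le]; exact PiLp.norm_apply_le h i
      · exact SignedRadonMeasure.enorm_integral_le μ hψ.continuous hc i
    _ = _ := by simp [mul_assoc]

/-! ### The L¹ translation estimate, by mollification -/

section Mollification

open scoped Convolution

variable {n : ℕ} {φ : EuclideanSpace ℝ (Fin n) → ℝ} {G : Measure (EuclideanSpace ℝ (Fin n))}

/-- The derivative falls on the mollifier, and y ↦ f(z − y) is itself a test function. -/
theorem GradBound.enorm_fderiv_convolution_le (hG : GradBound φ G) (hφ : LocallyIntegrable φ)
    {f : EuclideanSpace ℝ (Fin n) → ℝ} (hf : ContDiff ℝ ∞ f) (hc : HasCompactSupport f)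
    (z h : EuclideanSpace ℝ (Fin n)) :
    ‖fderiv ℝ (f ⋆[ContinuousLinearMap.lsmul ℝ ℝ, volume] φ) z h‖ₑ ≤
      n * ‖h‖ₑ * ∫⁻ y, ‖f (z - y)‖ₑ ∂G := by
  have hd := hc.hasFDerivAt_convolution_left (μ := volume) (ContinuousLinearMap.lsmul ℝ ℝ)
    (hf.of_le (by simp)) hφ z
  have hex : ConvolutionExistsAt (fderiv ℝ f) φ z
      ((ContinuousLinearMap.lsmul ℝ ℝ : ℝ →L[ℝ] ℝ →L[ℝ] ℝ).precompL _) volume :=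
    (hc.fderiv (𝕜 := ℝ)).convolutionExists_left _ (hf.continuous_fderiv (by simp)) hφ z
  set ψ : EuclideanSpace ℝ (Fin n) → ℝ := fun y => f (z - y) with hψdef
  have hψ : ContDiff ℝ ∞ ψ := hf.comp (contDiff_const.sub contDiff_id)
  have hψc : HasCompactSupport ψ := hc.comp_homeomorph (Homeomorph.subLeft z)
  have hψd : ∀ y, fderiv ℝ ψ y h = - fderiv ℝ f (z - y) h := fun y => by
    have h1 : HasFDerivAt f (fderiv ℝ f (z - y)) (z - y) :=
      (hf.differentiable (by simp) _).hasFDerivAt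
    have h2 : HasFDerivAt (fun y => z - y) (-ContinuousLinearMap.id ℝ _) y :=
      (hasFDerivAt_id y).const_sub z
    have h3 := (h1.comp y h2).fderiv
    have : ψ = f ∘ fun y => z - y := rfl
    rw [this, h3]
    simp
  have hval : fderiv ℝ (f ⋆[ContinuousLinearMap.lsmul ℝ ℝ, volume] φ) z h
      = - ∫ y, φ y * fderiv ℝ ψ y h := by
    rw [hd.fderiv, convolution_def, ContinuousLinearMap.integral_apply hex]
    simp only [ContinuousLinearMap.precompL_apply, ContinuousLinearMap.lsmul_apply, smul_eq_mul]
    rw [← integral_sub_left_eq_self _ volume z, ← integral_neg]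
    refine integral_congr_ae (Eventually.of_forall fun y => ?_)
    simp only [hψd, sub_sub_cancel]
    ring
  rw [hval, enorm_neg]
  exact hG ψ hψ hψc h

theorem GradBound.enorm_convolution_sub_le (hG : GradBound φ G) (hφ : LocallyIntegrable φ)
    {f : EuclideanSpace ℝ (Fin n) → ℝ} (hf : ContDiff ℝ ∞ f) (hc : HasCompactSupport f)
    (y h : EuclideanSpace ℝ (Fin n)) :
    ‖(f ⋆[ContinuousLinearMap.lsmul ℝ ℝ, volume] φ) (y + h) -
      (f ⋆[ContinuousLinearMap.lsmul ℝ ℝ, volume] φ) y‖ₑ ≤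
      ∫⁻ τ in Ioc (0 : ℝ) 1, n * ‖h‖ₑ * ∫⁻ w, ‖f (y + τ • h - w)‖ₑ ∂G := by
  set F := f ⋆[ContinuousLinearMap.lsmul ℝ ℝ, volume] φ with hF
  have hFd : ContDiff ℝ ∞ F :=
    hc.contDiff_convolution_left (ContinuousLinearMap.lsmul ℝ ℝ) hf hφ
  have hder : ∀ τ : ℝ, HasDerivAt (fun τ : ℝ => F (y + τ • h)) (fderiv ℝ F (y + τ • h) h) τ := by
    intro τ
    have h1 : HasFDerivAt F (fderiv ℝ F (y + τ • h)) (y + τ • h) :=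
      (hFd.differentiable (by simp) _).hasFDerivAt
    have h2 : HasDerivAt (fun τ : ℝ => y + τ • h) h τ := by
      simpa using ((hasDerivAt_id τ).smul_const h).const_add y
    exact h1.comp_hasDerivAt τ h2
  have hcont : Continuous fun τ : ℝ => fderiv ℝ F (y + τ • h) h :=
    ((hFd.continuous_fderiv (by simp)).comp (by fun_prop)).clm_apply continuous_const
  have hftc := intervalIntegral.integral_eq_sub_of_hasDerivAt (a := 0) (b := 1)
    (fun τ _ => hder τ) (hcont.intervalIntegrable _ _)
  simp only [one_smul, zero_smul, add_zero] at hftc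
  rw [← hftc, intervalIntegral.integral_of_le zero_le_one]
  refine (enorm_integral_le_lintegral_enorm _).trans (lintegral_mono fun τ => ?_)
  exact hG.enorm_fderiv_convolution_le hφ hf hc _ _

/-- By Tonelli, each w carries the mass of a translate of f over B(x,r). This is at most 1, and it
is 0 unless w lies within r + ‖h‖ + `b.rOut` of x. -/
theorem GradBound.lintegral_convolution_sub_le [SFinite G] (hG : GradBound φ G)
    (hφ : LocallyIntegrable φ) (b : ContDiffBump (0 : EuclideanSpace ℝ (Fin n)))
    (x h : EuclideanSpace ℝ (Fin n)) {r ρ : ℝ} (hρ : r + ‖h‖ + b.rOut ≤ ρ) :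
    ∫⁻ y in Metric.ball x r, ‖(b.normed volume ⋆[ContinuousLinearMap.lsmul ℝ ℝ, volume] φ) (y + h) -
      (b.normed volume ⋆[ContinuousLinearMap.lsmul ℝ ℝ, volume] φ) y‖ₑ ≤
      n * ‖h‖ₑ * G (Metric.ball x ρ) := by
  set f := b.normed volume with hfdef
  have hf : ContDiff ℝ ∞ f := b.contDiff_normed
  have hc : HasCompactSupport f := b.hasCompactSupport_normed
  have hone : ∫⁻ y, ‖f y‖ₑ = 1 := by
    rw [← ofReal_integral_norm_eq_lintegral_enorm b.integrable_normed]
    simp_rw [Real.norm_of_nonneg (b.nonneg_normed _)]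
    rw [b.integral_normed, ENNReal.ofReal_one]
  have hinner : ∀ τ ∈ Ioc (0 : ℝ) 1, ∫⁻ w, (∫⁻ y in Metric.ball x r, ‖f (y + τ • h - w)‖ₑ) ∂G
      ≤ G (Metric.ball x ρ) := by
    intro τ hτ
    rw [← lintegral_indicator_one Metric.isOpen_ball.measurableSet]
    refine lintegral_mono fun w => ?_
    by_cases hw : w ∈ Metric.ball x ρ
    · rw [indicator_of_mem hw, Pi.one_apply]
      calc ∫⁻ y in Metric.ball x r, ‖f (y + τ • h - w)‖ₑ ≤ ∫⁻ y, ‖f (y + τ • h - w)‖ₑ :=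
            setLIntegral_le_lintegral _ _
        _ = ∫⁻ y, ‖f (y + (τ • h - w))‖ₑ := by simp_rw [add_sub_assoc]
        _ = 1 := by rw [lintegral_add_right_eq_self (fun y => ‖f y‖ₑ), hone]
    · rw [indicator_of_notMem hw]
      refine le_of_eq ?_
      refine setLIntegral_eq_zero Metric.isOpen_ball.measurableSet fun y hy => ?_
      simp only [Pi.zero_apply, enorm_eq_zero]
      by_contra hne
      have hsupp : y + τ • h - w ∈ Function.support f := hne
      rw [hfdef, b.support_normed_eq, mem_ball_zero_iff] at hsupp
      apply hw
      rw [mem_ball_iff_norm]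
      rw [mem_ball_iff_norm] at hy
      have hτh : ‖τ • h‖ ≤ ‖h‖ := by
        rw [norm_smul, Real.norm_of_nonneg hτ.1.le]
        exact mul_le_of_le_one_left (norm_nonneg _) hτ.2
      calc ‖w - x‖ = ‖-(y + τ • h - w) + (y - x) + τ • h‖ := by congr 1; abel
        _ ≤ ‖-(y + τ • h - w)‖ + ‖y - x‖ + ‖τ • h‖ := norm_add₃_le
        _ < ρ := by rw [norm_neg]; linarith
  have hfm : Measurable fun y => ‖f y‖ₑ := hf.continuous.enorm.measurable
  calc _ ≤ ∫⁻ y in Metric.ball x r, ∫⁻ τ in Ioc (0 : ℝ) 1,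
          n * ‖h‖ₑ * ∫⁻ w, ‖f (y + τ • h - w)‖ₑ ∂G :=
        lintegral_mono fun y => hG.enorm_convolution_sub_le hφ hf hc y h
    _ = ∫⁻ τ in Ioc (0 : ℝ) 1, ∫⁻ y in Metric.ball x r,
          n * ‖h‖ₑ * ∫⁻ w, ‖f (y + τ • h - w)‖ₑ ∂G := by
        refine lintegral_lintegral_swap (Measurable.aemeasurable ?_)
        refine Measurable.const_mul ?_ _
        exact Measurable.lintegral_prod_right' (ν := G)
          (f := fun p : (EuclideanSpace ℝ (Fin n) × ℝ) × EuclideanSpace ℝ (Fin n) =>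
            ‖f (p.1.1 + p.1.2 • h - p.2)‖ₑ) (hfm.comp (by fun_prop))
    _ = ∫⁻ τ in Ioc (0 : ℝ) 1, n * ‖h‖ₑ * ∫⁻ w, (∫⁻ y in Metric.ball x r,
          ‖f (y + τ • h - w)‖ₑ) ∂G := by
        refine lintegral_congr fun τ => ?_
        rw [lintegral_const_mul, lintegral_lintegral_swap]
        · exact (hfm.comp (by fun_prop)).aemeasurable
        · exact Measurable.lintegral_prod_right' (ν := G)
            (f := fun p : EuclideanSpace ℝ (Fin n) × EuclideanSpace ℝ (Fin n) =>
            ‖f (p.1 + τ • h - p.2)‖ₑ) (hfm.comp (by fun_prop))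
    _ ≤ ∫⁻ _τ in Ioc (0 : ℝ) 1, n * ‖h‖ₑ * G (Metric.ball x ρ) := by
        refine setLIntegral_mono measurable_const fun τ hτ => ?_
        gcongr
        exact hinner τ hτ
    _ = n * ‖h‖ₑ * G (Metric.ball x ρ) := by simp

/-- The `L¹` modulus of continuity of a function of bounded variation on a ball. -/
theorem GradBound.lintegral_translate_sub_le [SFinite G] (hG : GradBound φ G)
    (hφ : LocallyIntegrable φ) (x h : EuclideanSpace ℝ (Fin n)) {r ρ : ℝ} (hρ : r + ‖h‖ < ρ) :
    ∫⁻ y in Metric.ball x r, ‖φ (y + h) - φ y‖ₑ ≤ n * ‖h‖ₑ * G (Metric.ball x ρ) := by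
  set δ := ρ - (r + ‖h‖) with hδ
  have hδ0 : 0 < δ := sub_pos.2 hρ
  have hu : ∀ k : ℕ, 0 < (1 : ℝ) / (k + 1) := fun k => Nat.one_div_pos_of_nat
  -- The outer radii are at most δ, the room left between r + ‖h‖ and ρ. The fixed ratio 2 of the
  -- radii is what the almost everywhere convergence of the mollifications requires.
  let b : ℕ → ContDiffBump (0 : EuclideanSpace ℝ (Fin n)) := fun k =>
    ⟨δ / 2 * (1 / (k + 1)), δ * (1 / (k + 1)), mul_pos (half_pos hδ0) (hu k),
      mul_lt_mul_of_pos_right (half_lt_self hδ0) (hu k)⟩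
  have hlim : Tendsto (fun k => (b k).rOut) atTop (𝓝 0) := by
    simpa [b] using (tendsto_one_div_add_atTop_nhds_zero_nat (𝕜 := ℝ)).const_mul δ
  have hae := ContDiffBump.ae_convolution_tendsto_right_of_locallyIntegrable (μ := volume)
    (φ := b) (K := 2) hlim (Eventually.of_forall fun k => le_of_eq (by simp only [b]; ring)) hφ
  have hae' := (quasiMeasurePreserving_add_right (volume : Measure (EuclideanSpace ℝ (Fin n))) h).ae
    hae
  set F : ℕ → EuclideanSpace ℝ (Fin n) → ℝ := fun k =>
    (b k).normed volume ⋆[ContinuousLinearMap.lsmul ℝ ℝ, volume] φ with hF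
  have hFc : ∀ k, Continuous (F k) := fun k =>
    ((b k).hasCompactSupport_normed.contDiff_convolution_left (ContinuousLinearMap.lsmul ℝ ℝ)
      ((b k).contDiff_normed (n := 1)) hφ).continuous
  -- Fatou's lemma: the bound for the mollified functions is uniform in k.
  calc ∫⁻ y in Metric.ball x r, ‖φ (y + h) - φ y‖ₑ
      = ∫⁻ y in Metric.ball x r, liminf (fun k => ‖F k (y + h) - F k y‖ₑ) atTop := by
        refine lintegral_congr_ae (ae_restrict_of_ae ?_)
        filter_upwards [hae, hae'] with y h1 h2
        exact ((h2.sub h1).enorm.liminf_eq).symm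
    _ ≤ liminf (fun k => ∫⁻ y in Metric.ball x r, ‖F k (y + h) - F k y‖ₑ) atTop := by
        refine lintegral_liminf_le fun k => ?_
        have := hFc k
        exact (Continuous.enorm (by fun_prop)).measurable
    _ ≤ n * ‖h‖ₑ * G (Metric.ball x ρ) := by
        refine liminf_le_of_le (by isBoundedDefault) fun c hc => ?_
        obtain ⟨k, hk⟩ := hc.exists
        refine hk.trans (hG.lintegral_convolution_sub_le hφ (b k) x h ?_)
        have : (b k).rOut ≤ δ := by
          have : (1 : ℝ) / (k + 1) ≤ 1 := by
            rw [div_le_one (by positivity)]; linarith [Nat.cast_nonneg (α := ℝ) k]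
          exact mul_le_of_le_one_right hδ0.le this
        linarith

end Mollification

/-! ### Mean oscillation and comparison of averages over balls -/

section Averages

variable {n : ℕ} {φ : EuclideanSpace ℝ (Fin n) → ℝ} {G : Measure (EuclideanSpace ℝ (Fin n))}

theorem integrableOn_ball_of_locallyIntegrable (hφ : LocallyIntegrable φ)
    (x : EuclideanSpace ℝ (Fin n)) (r : ℝ) : IntegrableOn φ (Metric.ball x r) :=
  (hφ.integrableOn_isCompact (isCompact_closedBall x r)).mono_set Metric.ball_subset_closedBall

theorem volume_ball_eq (x : EuclideanSpace ℝ (Fin n)) {r : ℝ} (hr : 0 < r) :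
    volume (Metric.ball x r) =
      ENNReal.ofReal (r ^ n) * volume (Metric.ball (0 : EuclideanSpace ℝ (Fin n)) 1) := by
  rw [Measure.addHaar_ball_of_pos _ _ hr, finrank_euclideanSpace_fin]

theorem volumeReal_ball_eq (x : EuclideanSpace ℝ (Fin n)) {r : ℝ} (hr : 0 < r) :
    volume.real (Metric.ball x r) =
      r ^ n * volume.real (Metric.ball (0 : EuclideanSpace ℝ (Fin n)) 1) := by
  rw [measureReal_def, volume_ball_eq x hr, ENNReal.toReal_mul,
    ENNReal.toReal_ofReal (pow_nonneg hr.le n), measureReal_def]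

theorem volumeReal_ball_pos (x : EuclideanSpace ℝ (Fin n)) {r : ℝ} (hr : 0 < r) :
    0 < volume.real (Metric.ball x r) :=
  ENNReal.toReal_pos (Metric.measure_ball_pos volume x hr).ne' measure_ball_lt_top.ne

/-- A weak form of the Poincaré inequality, with a larger ball on the right-hand side. -/
theorem GradBound.lintegral_lintegral_sub_le [SFinite G] (hG : GradBound φ G)
    (hφ : LocallyIntegrable φ) (x : EuclideanSpace ℝ (Fin n)) (r : ℝ) :
    ∫⁻ y in Metric.ball x r, ∫⁻ z in Metric.ball x r, ‖φ z - φ y‖ₑ ≤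
      volume (Metric.ball (0 : EuclideanSpace ℝ (Fin n)) (2 * r)) *
        (n * ENNReal.ofReal (2 * r) * G (Metric.ball x (3 * r))) := by
  have hmB : ∀ (x : EuclideanSpace ℝ (Fin n)) r, MeasurableSet (Metric.ball x r) :=
    fun x r => Metric.isOpen_ball.measurableSet
  have hφm : AEMeasurable φ := hφ.aestronglyMeasurable.aemeasurable
  calc ∫⁻ y in Metric.ball x r, ∫⁻ z in Metric.ball x r, ‖φ z - φ y‖ₑ
      -- Substitute z = y + h. Two points of B(x,r) differ by some h with ‖h‖ < 2r, and for fixed h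
      -- the translation estimate applies with r + ‖h‖ < 3r.
      ≤ ∫⁻ y in Metric.ball x r, ∫⁻ h in Metric.ball (0 : EuclideanSpace ℝ (Fin n)) (2 * r),
          ‖φ (y + h) - φ y‖ₑ := by
        refine setLIntegral_mono' (hmB x r) fun y hy => ?_
        rw [← lintegral_indicator (hmB x r), ← lintegral_indicator (hmB 0 (2 * r)),
          ← lintegral_add_left_eq_self _ y]
        refine lintegral_mono fun h => ?_
        by_cases hh : y + h ∈ Metric.ball x r
        · have : h ∈ Metric.ball (0 : EuclideanSpace ℝ (Fin n)) (2 * r) := by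
            rw [mem_ball_iff_norm] at hh hy
            rw [mem_ball_zero_iff]
            calc ‖h‖ = ‖(y + h - x) - (y - x)‖ := by congr 1; abel
              _ ≤ ‖y + h - x‖ + ‖y - x‖ := norm_sub_le _ _
              _ < 2 * r := by linarith
          rw [indicator_of_mem hh, indicator_of_mem this]
        · rw [indicator_of_notMem hh]
          exact zero_le
    _ = ∫⁻ h in Metric.ball (0 : EuclideanSpace ℝ (Fin n)) (2 * r), ∫⁻ y in Metric.ball x r,
          ‖φ (y + h) - φ y‖ₑ := by
        refine lintegral_lintegral_swap ?_
        rw [Measure.prod_restrict]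
        refine AEMeasurable.restrict ?_
        have h1 : AEMeasurable (fun p : EuclideanSpace ℝ (Fin n) × EuclideanSpace ℝ (Fin n) =>
            φ (p.1 + p.2)) (volume.prod volume) :=
          hφm.comp_quasiMeasurePreserving (Measure.quasiMeasurePreserving_snd.comp
            (measurePreserving_prod_add volume volume).quasiMeasurePreserving)
        have h2 : AEMeasurable (fun p : EuclideanSpace ℝ (Fin n) × EuclideanSpace ℝ (Fin n) =>
            φ p.1) (volume.prod volume) :=
          hφm.comp_quasiMeasurePreserving Measure.quasiMeasurePreserving_fst
        exact (h1.sub h2).enorm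
    _ ≤ ∫⁻ _h in Metric.ball (0 : EuclideanSpace ℝ (Fin n)) (2 * r),
          n * ENNReal.ofReal (2 * r) * G (Metric.ball x (3 * r)) := by
        refine setLIntegral_mono' (hmB _ _) fun h hh => ?_
        rw [mem_ball_zero_iff] at hh
        refine (hG.lintegral_translate_sub_le hφ x h (ρ := 3 * r) (by linarith)).trans ?_
        gcongr
        rw [← ofReal_norm]
        exact ENNReal.ofReal_le_ofReal hh.le
    _ = _ := by rw [lintegral_const, Measure.restrict_apply_univ, mul_comm]

theorem volume_mul_enorm_sub_average_le {B : Set (EuclideanSpace ℝ (Fin n))}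
    (hB : volume B ≠ 0) (hB' : volume B ≠ ⊤) (hφ : IntegrableOn φ B) (c : ℝ) :
    volume B * ‖c - ⨍ y in B, φ y‖ₑ ≤ ∫⁻ y in B, ‖c - φ y‖ₑ := by
  have h1 : volume.real B * (c - ⨍ y in B, φ y) = ∫ y in B, (c - φ y) := by
    have hc : IntegrableOn (fun _ => c) B := integrableOn_const hB'
    have hpos : volume.real B ≠ 0 := (ENNReal.toReal_pos hB hB').ne'
    rw [integral_sub hc hφ, setIntegral_const, setAverage_eq, smul_eq_mul, smul_eq_mul]
    field_simp
  calc volume B * ‖c - ⨍ y in B, φ y‖ₑ = ‖volume.real B * (c - ⨍ y in B, φ y)‖ₑ := by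
        rw [enorm_mul, Real.enorm_of_nonneg measureReal_nonneg, ofReal_measureReal hB']
    _ = ‖∫ y in B, (c - φ y)‖ₑ := by rw [h1]
    _ ≤ _ := enorm_integral_le_lintegral_enorm _

theorem abs_average_sub_le {B : Set (EuclideanSpace ℝ (Fin n))}
    (hB : volume B ≠ 0) (hB' : volume B ≠ ⊤) (hφ : IntegrableOn φ B) (c : ℝ) :
    |(⨍ y in B, φ y) - c| ≤ ⨍ y in B, |φ y - c| := by
  have hc : IntegrableOn (fun _ => c) B := integrableOn_const hB'
  have hpos : 0 < volume.real B := ENNReal.toReal_pos hB hB'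
  have h1 : (⨍ y in B, φ y) - c = ⨍ y in B, (φ y - c) := by
    rw [setAverage_eq, setAverage_eq, integral_sub hφ hc, setIntegral_const, smul_eq_mul,
      smul_eq_mul, smul_eq_mul]
    field_simp
  rw [h1, setAverage_eq, setAverage_eq, smul_eq_mul, smul_eq_mul, abs_mul,
    abs_of_pos (inv_pos.2 hpos)]
  gcongr
  exact abs_integral_le_integral_abs

/-- Mean oscillation bound over a ball. -/
theorem GradBound.lintegral_sub_average_le [SFinite G] (hG : GradBound φ G)
    (hφ : LocallyIntegrable φ) (x : EuclideanSpace ℝ (Fin n)) {r : ℝ} (hr : 0 < r) :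
    ∫⁻ z in Metric.ball x r, ‖φ z - ⨍ y in Metric.ball x r, φ y‖ₑ ≤
      ENNReal.ofReal (2 ^ n * n * (2 * r)) * G (Metric.ball x (3 * r)) := by
  set B := Metric.ball x r with hBdef
  have hB : volume B ≠ 0 := (Metric.measure_ball_pos volume x hr).ne'
  have hB' : volume B ≠ ⊤ := measure_ball_lt_top.ne
  -- The factor |B| keeps averages out of the extended reals until the end. The 2^n is the ratio of
  -- |B(0,2r)| to |B|.
  have h1 : volume B * ∫⁻ z in B, ‖φ z - ⨍ y in B, φ y‖ₑ ≤
      volume B * (ENNReal.ofReal (2 ^ n * n * (2 * r)) * G (Metric.ball x (3 * r))) := by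
    calc volume B * ∫⁻ z in B, ‖φ z - ⨍ y in B, φ y‖ₑ
        = ∫⁻ z in B, volume B * ‖φ z - ⨍ y in B, φ y‖ₑ := by
          rw [lintegral_const_mul' _ _ hB']
      _ ≤ ∫⁻ z in B, ∫⁻ y in B, ‖φ z - φ y‖ₑ := lintegral_mono fun z =>
          volume_mul_enorm_sub_average_le hB hB' (integrableOn_ball_of_locallyIntegrable hφ x r) _
      _ = ∫⁻ z in B, ∫⁻ y in B, ‖φ y - φ z‖ₑ := by simp_rw [enorm_sub_rev]
      _ ≤ _ := hG.lintegral_lintegral_sub_le hφ x r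
      _ = _ := by
          have h2 : (n : ℝ≥0∞) = ENNReal.ofReal n := by simp
          rw [volume_ball_eq _ (by positivity : 0 < 2 * r), hBdef, volume_ball_eq x hr, mul_pow,
            ENNReal.ofReal_mul (p := 2 ^ n) (q := r ^ n) (by positivity),
            ENNReal.ofReal_mul (p := 2 ^ n * n) (by positivity),
            ENNReal.ofReal_mul (p := 2 ^ n) (q := n) (by positivity), h2]
          ring
  exact (ENNReal.mul_le_mul_iff_right hB hB').1 h1

/-- Translation by w − z carries B(z,r) onto B(w,r), so the difference of the averages is the
average of an increment of φ. -/
theorem GradBound.volume_mul_enorm_average_sub_le [SFinite G] (hG : GradBound φ G)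
    (hφ : LocallyIntegrable φ) (z w : EuclideanSpace ℝ (Fin n)) {r ρ : ℝ} (hr : 0 < r)
    (hρ : r + ‖w - z‖ < ρ) :
    volume (Metric.ball z r) * ‖(⨍ y in Metric.ball w r, φ y) - ⨍ y in Metric.ball z r, φ y‖ₑ ≤
      n * ‖w - z‖ₑ * G (Metric.ball z ρ) := by
  have hB' : volume (Metric.ball z r) ≠ ⊤ := measure_ball_lt_top.ne
  have hmp := measurePreserving_add_right (volume : Measure (EuclideanSpace ℝ (Fin n))) (w - z)
  have hemb : MeasurableEmbedding fun y : EuclideanSpace ℝ (Fin n) => y + (w - z) :=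
    measurableEmbedding_addRight _
  have hpre : (fun y => y + (w - z)) ⁻¹' Metric.ball w r = Metric.ball z r := by
    ext y
    simp only [mem_preimage, mem_ball_iff_norm]
    rw [show y + (w - z) - w = y - z by abel]
  have h1 : ∫ y in Metric.ball w r, φ y = ∫ y in Metric.ball z r, φ (y + (w - z)) := by
    rw [← hpre]
    exact (hmp.setIntegral_preimage_emb hemb φ _).symm
  have h2 : IntegrableOn (fun y => φ (y + (w - z))) (Metric.ball z r) := by
    rw [← hpre]
    exact (hmp.integrableOn_comp_preimage hemb).2 (integrableOn_ball_of_locallyIntegrable hφ w r)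
  have hvol : volume.real (Metric.ball w r) = volume.real (Metric.ball z r) := by
    rw [volumeReal_ball_eq w hr, volumeReal_ball_eq z hr]
  have hpos := volumeReal_ball_pos z hr
  have h3 : volume.real (Metric.ball z r) *
      ((⨍ y in Metric.ball w r, φ y) - ⨍ y in Metric.ball z r, φ y) =
      ∫ y in Metric.ball z r, (φ (y + (w - z)) - φ y) := by
    rw [integral_sub h2 (integrableOn_ball_of_locallyIntegrable hφ z r), setAverage_eq, setAverage_eq,
      h1, hvol, smul_eq_mul, smul_eq_mul]
    field_simp
  calc _ = ‖volume.real (Metric.ball z r) *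
      ((⨍ y in Metric.ball w r, φ y) - ⨍ y in Metric.ball z r, φ y)‖ₑ := by
        rw [enorm_mul, Real.enorm_of_nonneg measureReal_nonneg, ofReal_measureReal hB']
    _ ≤ ∫⁻ y in Metric.ball z r, ‖φ (y + (w - z)) - φ y‖ₑ := by
        rw [h3]; exact enorm_integral_le_lintegral_enorm _
    _ ≤ _ := hG.lintegral_translate_sub_le hφ z (w - z) hρ

/-- Enlarging the ball costs only the ratio of the volumes, at most 2^n. -/
theorem average_ball_abs_sub_le (hφ : LocallyIntegrable φ) (x : EuclideanSpace ℝ (Fin n))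
    {r r' : ℝ} (hr' : 0 < r') (h1 : r' ≤ r) (h2 : r ≤ 2 * r') (c : ℝ) :
    ⨍ y in Metric.ball x r', |φ y - c| ≤ 2 ^ n * ⨍ y in Metric.ball x r, |φ y - c| := by
  have hr : 0 < r := hr'.trans_le h1
  have hint : IntegrableOn (fun y => |φ y - c|) (Metric.ball x r) :=
    ((integrableOn_ball_of_locallyIntegrable hφ x r).sub
      (integrableOn_const measure_ball_lt_top.ne)).abs
  have hω : 0 < volume.real (Metric.ball (0 : EuclideanSpace ℝ (Fin n)) 1) :=
    volumeReal_ball_pos 0 one_pos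
  rw [setAverage_eq, setAverage_eq, smul_eq_mul, smul_eq_mul, volumeReal_ball_eq x hr',
    volumeReal_ball_eq x hr, ← mul_assoc]
  refine mul_le_mul ?_ ?_ (integral_nonneg fun _ => abs_nonneg _) (by positivity)
  · rw [← div_eq_mul_inv, le_div_iff₀ (by positivity), inv_mul_eq_div, div_le_iff₀ (by positivity)]
    have : r ^ n ≤ 2 ^ n * r' ^ n := by
      rw [← mul_pow]; exact pow_le_pow_left₀ hr.le h2 n
    nlinarith
  · exact setIntegral_mono_set hint (Eventually.of_forall fun _ => abs_nonneg _)
      (Metric.ball_subset_ball h1).eventuallyLE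

end Averages

/-! ### Approximate limits where the gradient measure has growth n − 1 + s -/

section ApproximateLimit

variable {n : ℕ} {φ : EuclideanSpace ℝ (Fin n) → ℝ} {G : Measure (EuclideanSpace ℝ (Fin n))}

/-- The constant in the mean oscillation estimate for a gradient measure of growth `n - 1 + s`. -/
noncomputable def oscConst (n : ℕ) (s : ℝ) : ℝ :=
  2 ^ n * n * 2 * 3 ^ ((n : ℝ) - 1 + s) /
    volume.real (Metric.ball (0 : EuclideanSpace ℝ (Fin n)) 1)

theorem oscConst_nonneg (n : ℕ) (s : ℝ) : 0 ≤ oscConst n s := by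
  unfold oscConst; positivity

/-- The exponent count in space: the factor r of a Poincaré estimate times the growth r^(n−1+s),
divided by the volume r^n, leaves r^s. -/
theorem mul_rpow_sub_one_add {r : ℝ} (hr : 0 < r) (n : ℕ) (s : ℝ) :
    r * r ^ ((n : ℝ) - 1 + s) = r ^ n * r ^ s := by
  rw [← Real.rpow_natCast, ← Real.rpow_add hr]
  nth_rewrite 1 [← Real.rpow_one r]
  rw [← Real.rpow_add hr]
  congr 1; ring

theorem GradBound.average_abs_sub_average_le [SFinite G] (hG : GradBound φ G)
    (hφ : LocallyIntegrable φ) {s : ℝ} {x : EuclideanSpace ℝ (Fin n)} {P r : ℝ} (hr : 0 < r)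
    (hP : 0 ≤ P) (hgrow : G (Metric.ball x (3 * r)) ≤
      ENNReal.ofReal ((3 * r) ^ ((n : ℝ) - 1 + s) * P)) :
    ⨍ z in Metric.ball x r, |φ z - ⨍ y in Metric.ball x r, φ y| ≤ oscConst n s * r ^ s * P := by
  have hω : 0 < volume.real (Metric.ball (0 : EuclideanSpace ℝ (Fin n)) 1) :=
    volumeReal_ball_pos 0 one_pos
  have hint : IntegrableOn (fun z => φ z - ⨍ y in Metric.ball x r, φ y) (Metric.ball x r) :=
    (integrableOn_ball_of_locallyIntegrable hφ x r).sub (integrableOn_const measure_ball_lt_top.ne)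
  have h1 : ∫ z in Metric.ball x r, |φ z - ⨍ y in Metric.ball x r, φ y| ≤
      2 ^ n * n * (2 * r) * ((3 * r) ^ ((n : ℝ) - 1 + s) * P) := by
    rw [← ENNReal.ofReal_le_ofReal_iff (by positivity)]
    simp_rw [← Real.norm_eq_abs]
    rw [ofReal_integral_norm_eq_lintegral_enorm hint, ENNReal.ofReal_mul (by positivity)]
    refine (hG.lintegral_sub_average_le hφ x hr).trans ?_
    gcongr
  rw [setAverage_eq, smul_eq_mul, volumeReal_ball_eq x hr, inv_mul_le_iff₀ (by positivity)]
  refine h1.trans (le_of_eq ?_)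
  rw [Real.mul_rpow (by norm_num) hr.le]
  have := mul_rpow_sub_one_add hr n s
  unfold oscConst
  field_simp
  linear_combination n * P * this

/-- A point at which the gradient measure has growth of order `n - 1 + s` is a point of approximate
continuity, with a rate for the convergence of the averages. -/
theorem GradBound.exists_hasApproxLimit [SFinite G] (hG : GradBound φ G)
    (hφ : LocallyIntegrable φ) {s : ℝ} (hs : 0 < s) {x : EuclideanSpace ℝ (Fin n)} {P R : ℝ}
    (hR : 0 < R) (hP : 0 ≤ P) (hgrow : ∀ r, 0 < r → r ≤ R → G (Metric.ball x (3 * r)) ≤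
      ENNReal.ofReal ((3 * r) ^ ((n : ℝ) - 1 + s) * P)) :
    ∃ l, HasApproxLimit φ x l ∧ |(⨍ y in Metric.ball x R, φ y) - l| ≤
      2 ^ n * oscConst n s / (1 - 2 ^ (-s)) * R ^ s * P := by
  set θ : ℝ := 2 ^ (-s) with hθ
  have hθ0 : 0 < θ := by positivity
  have hθ1 : θ < 1 := Real.rpow_lt_one_of_one_lt_of_neg one_lt_two (neg_lt_zero.2 hs)
  set q : ℕ → ℝ := fun k => R * (1 / 2) ^ k with hq
  have hq0 : ∀ k, 0 < q k := fun k => by positivity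
  have hqR : ∀ k, q k ≤ R := fun k =>
    mul_le_of_le_one_right hR.le (pow_le_one₀ (by norm_num) (by norm_num))
  have hqs : ∀ k, (q k) ^ s = R ^ s * θ ^ k := fun k => by
    simp only [hq]
    rw [Real.mul_rpow hR.le (by positivity), ← Real.rpow_natCast, ← Real.rpow_natCast,
      ← Real.rpow_mul (by norm_num), hθ, ← Real.rpow_mul (by norm_num), one_div,
      Real.inv_rpow (by norm_num), ← Real.rpow_neg (by norm_num)]
    congr 2; ring
  set u : ℕ → ℝ := fun k => ⨍ y in Metric.ball x (q k), φ y with hu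
  have hosc : ∀ k, ⨍ z in Metric.ball x (q k), |φ z - u k| ≤ oscConst n s * R ^ s * P * θ ^ k :=
    fun k => (hG.average_abs_sub_average_le hφ (hq0 k) hP (hgrow _ (hq0 k) (hqR k))).trans
      (le_of_eq (by rw [hqs]; ring))
  have hB : ∀ r, 0 < r → volume (Metric.ball x r) ≠ 0 := fun r hr =>
    (Metric.measure_ball_pos volume x hr).ne'
  have hB' : ∀ r, volume (Metric.ball x r) ≠ ⊤ := fun r => measure_ball_lt_top.ne
  set A := 2 ^ n * (oscConst n s * R ^ s * P) with hA
  have hA0 : 0 ≤ A := by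
    have := oscConst_nonneg n s
    positivity
  -- Halving the radius changes the average by at most 2^n times the mean oscillation on the larger
  -- ball. These bounds form a geometric series of ratio θ = 2^(−s) < 1.
  have hstep : ∀ k, dist (u k) (u (k + 1)) ≤ A * θ ^ k := fun k => by
    have h2 : q k = 2 * q (k + 1) := by simp only [hq, pow_succ]; ring
    rw [dist_comm, Real.dist_eq]
    calc |u (k + 1) - u k| ≤ ⨍ z in Metric.ball x (q (k + 1)), |φ z - u k| :=
          abs_average_sub_le (hB _ (hq0 _)) (hB' _) (integrableOn_ball_of_locallyIntegrable hφ _ _) _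
      _ ≤ 2 ^ n * ⨍ z in Metric.ball x (q k), |φ z - u k| :=
          average_ball_abs_sub_le hφ x (hq0 _) (by linarith [hq0 (k + 1)]) h2.le _
      _ ≤ 2 ^ n * (oscConst n s * R ^ s * P * θ ^ k) := by gcongr; exact hosc k
      _ = A * θ ^ k := by rw [hA]; ring
  obtain ⟨l, hl⟩ := cauchySeq_tendsto_of_complete (cauchySeq_of_le_geometric θ A hθ1 hstep)
  have hul : ∀ k, |u k - l| ≤ A * θ ^ k / (1 - θ) := fun k =>
    dist_le_of_le_geometric_of_tendsto θ A hθ1 hstep hl k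
  refine ⟨l, ?_, ?_⟩
  · set D := 2 ^ n * (A + A / (1 - θ)) with hD
    have hD0 : 0 ≤ D := by
      have : 0 < 1 - θ := sub_pos.2 hθ1
      positivity
    have hbound : ∀ r, 0 < r → r ≤ R →
        ⨍ y in Metric.ball x r, |φ y - l| ≤ D * (2 * r / R) ^ s := by
      intro r hr hrR
      -- An arbitrary radius is placed between two dyadic ones, so that r ≤ q k ≤ 2r.
      obtain ⟨k, hk1, hk2⟩ := exists_nat_pow_near_of_lt_one (x := r / R) (y := 1 / 2)
        (by positivity) ((div_le_one hR).2 hrR) (by norm_num) (by norm_num)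
      rw [lt_div_iff₀ hR] at hk1
      rw [div_le_iff₀ hR] at hk2
      have hr1 : r ≤ q k := by simp only [hq]; linarith
      have hr2 : q k ≤ 2 * r := by simp only [hq]; rw [pow_succ] at hk1; linarith
      have hi1 : IntegrableOn (fun y => |φ y - u k|) (Metric.ball x (q k)) :=
        ((integrableOn_ball_of_locallyIntegrable hφ _ _).sub (integrableOn_const (hB' _))).abs
      have hi2 : IntegrableOn (fun _ => |u k - l|) (Metric.ball x (q k)) :=
        integrableOn_const (hB' _)
      have hi3 : IntegrableOn (fun y => |φ y - l|) (Metric.ball x (q k)) :=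
        ((integrableOn_ball_of_locallyIntegrable hφ _ _).sub (integrableOn_const (hB' _))).abs
      have htri : ⨍ y in Metric.ball x (q k), |φ y - l| ≤
          (⨍ y in Metric.ball x (q k), |φ y - u k|) + |u k - l| := by
        have hc : |u k - l| = ⨍ _y in Metric.ball x (q k), |u k - l| :=
          (setAverage_const (hB _ (hq0 k)) (hB' _) _).symm
        rw [hc, setAverage_eq, setAverage_eq, setAverage_eq, ← smul_add, ← integral_add hi1 hi2]
        simp only [smul_eq_mul]
        refine mul_le_mul_of_nonneg_left ?_ (by positivity)
        exact integral_mono hi3 (hi1.add hi2) fun y => abs_sub_le _ _ _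
      have hθr : θ ^ k ≤ (2 * r / R) ^ s := by
        have h3 : θ ^ k = (q k / R) ^ s := by
          rw [Real.div_rpow (hq0 k).le hR.le, hqs]
          field_simp
        rw [h3]
        have := (hq0 k).le
        gcongr
      calc ⨍ y in Metric.ball x r, |φ y - l| ≤ 2 ^ n * ⨍ y in Metric.ball x (q k), |φ y - l| :=
            average_ball_abs_sub_le hφ x hr hr1 hr2 l
        _ ≤ 2 ^ n * (oscConst n s * R ^ s * P * θ ^ k + A * θ ^ k / (1 - θ)) := by
            gcongr
            exact htri.trans (add_le_add (hosc k) (hul k))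
        _ ≤ 2 ^ n * (A * θ ^ k + A * θ ^ k / (1 - θ)) := by
            gcongr
            rw [hA]
            refine le_mul_of_one_le_left ?_ (one_le_pow₀ one_le_two)
            have := oscConst_nonneg n s
            positivity
        _ = D * θ ^ k := by rw [hD]; ring
        _ ≤ D * (2 * r / R) ^ s := by gcongr
    have hlim : Tendsto (fun r : ℝ => D * (2 * r / R) ^ s) (𝓝[>] 0) (𝓝 0) := by
      have : ContinuousAt (fun r : ℝ => D * (2 * r / R) ^ s) 0 :=
        continuousAt_const.mul (ContinuousAt.rpow_const (by fun_prop) (Or.inr hs.le))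
      have h0 := this.tendsto
      simp only [mul_zero, zero_div, Real.zero_rpow hs.ne'] at h0
      exact h0.mono_left nhdsWithin_le_nhds
    refine squeeze_zero' (Eventually.of_forall fun r => ?_) ?_ hlim
    · rw [setAverage_eq]
      exact smul_nonneg (by positivity) (integral_nonneg fun _ => abs_nonneg _)
    · filter_upwards [Ioc_mem_nhdsGT hR] with r hr
      exact hbound r hr.1 hr.2
  -- The rate is the full geometric sum, started at q 0 = R.
  · have := hul 0
    simp only [hu, hq, pow_zero, mul_one] at this
    refine this.trans (le_of_eq ?_)
    rw [hA]; ring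

end ApproximateLimit

/-! ### The increment estimate along the path -/

section Spatial

variable {n : ℕ}

/-- After rescaling to the unit ball, choose a finite cover by balls of radius δ/2. Separated points
fall into balls with different centres, so the size of the cover serves as N. -/
theorem exists_card_le_of_separated_in_closedBall (n : ℕ) {δ : ℝ} (hδ : 0 < δ) :
    ∃ N : ℕ, ∀ (x₀ : EuclideanSpace ℝ (Fin n)) (D : ℝ) (k : ℕ)
      (f : Fin k → EuclideanSpace ℝ (Fin n)), 0 < D → (∀ i, dist (f i) x₀ ≤ D) →
      (∀ i j, i ≠ j → δ * D < dist (f i) (f j)) → k ≤ N := by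
  obtain ⟨t, -, htf, ht⟩ := (isCompact_closedBall (0 : EuclideanSpace ℝ (Fin n)) 1).finite_cover_balls
    (half_pos hδ)
  refine ⟨htf.toFinset.card, fun x₀ D k f hD hf hsep => ?_⟩
  have hg : ∀ i, ∃ c ∈ t, dist (D⁻¹ • (f i - x₀)) c < δ / 2 := fun i => by
    have : D⁻¹ • (f i - x₀) ∈ Metric.closedBall (0 : EuclideanSpace ℝ (Fin n)) 1 := by
      rw [mem_closedBall_zero_iff, norm_smul, norm_inv, Real.norm_of_nonneg hD.le, ← dist_eq_norm,
        inv_mul_le_iff₀ hD, mul_one]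
      exact hf i
    simpa using ht this
  choose g hgt hg using hg
  have hinj : Function.Injective g := fun i j hij => by
    by_contra hne
    have h1 := hg i
    have h2 := hg j
    rw [hij] at h1
    have h3 : dist (D⁻¹ • (f i - x₀)) (D⁻¹ • (f j - x₀)) < δ := by
      linarith [dist_triangle_right (D⁻¹ • (f i - x₀)) (D⁻¹ • (f j - x₀)) (g j)]
    rw [dist_smul₀, dist_sub_right, norm_inv, Real.norm_of_nonneg hD.le, inv_mul_lt_iff₀ hD] at h3
    linarith [hsep i j hne]
  have := Finset.card_le_card_of_injOn (s := Finset.univ) (t := htf.toFinset) g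
    (fun i _ => by simpa using hgt i) hinj.injOn
  simpa using this

/-- A continuous function along a path whose oscillation at scale `r` is at most `A` oscillates by
at most `(N + 1) A`, where `N` bounds the cardinality of `r`-separated sets of the path. -/
theorem abs_sub_le_of_card_separated_le {E : Type*} [PseudoMetricSpace E] {X : ℝ → E} {v : ℝ → ℝ}
    {a b r A : ℝ} {N : ℕ} (hv : ContinuousOn v (Icc a b))
    (hvA : ∀ t ∈ Icc a b, ∀ u ∈ Icc a b, dist (X t) (X u) ≤ r → |v t - v u| ≤ A)
    (hN : ∀ (k : ℕ) (f : Fin k → E), (∀ i, f i ∈ X '' Icc a b) →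
      (∀ i j, i ≠ j → r < dist (f i) (f j)) → k ≤ N)
    {t u : ℝ} (ht : t ∈ Icc a b) (hu : u ∈ Icc a b) : |v t - v u| ≤ (N + 1) * A := by
  by_contra! hlt
  have hsub : uIcc u t ⊆ Icc a b := uIcc_subset_Icc hu ht
  have hN0 : (0 : ℝ) < N + 1 := by positivity
  -- By the intermediate value theorem v takes N + 1 values with spacing |v t − v u|/(N + 1) > A.
  -- The corresponding points of the path are then pairwise more than r apart, one too many.
  have hval : ∀ j : Fin (N + 1), ∃ w ∈ Icc a b, v w = v u + (j / (N + 1)) * (v t - v u) := fun j => by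
    have hmem : v u + ((j : ℝ) / (N + 1)) * (v t - v u) ∈ uIcc (v u) (v t) := by
      have h0 : (0 : ℝ) ≤ (j : ℝ) / (N + 1) := by positivity
      have h1 : (j : ℝ) / (N + 1) ≤ 1 := by
        rw [div_le_one hN0]
        exact_mod_cast j.2.le
      have := (convex_uIcc (v u) (v t)).add_smul_sub_mem left_mem_uIcc right_mem_uIcc ⟨h0, h1⟩
      simpa using this
    obtain ⟨w, hw, hw'⟩ := intermediate_value_uIcc (hv.mono hsub) hmem
    exact ⟨w, hsub hw, hw'⟩
  choose w hw hwv using hval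
  have := hN (N + 1) (fun j => X (w j)) (fun j => mem_image_of_mem _ (hw j)) fun i j hij => by
    by_contra! hle
    have h1 := hvA _ (hw i) _ (hw j) hle
    rw [hwv, hwv] at h1
    have h2 : v u + (i / (N + 1)) * (v t - v u) - (v u + (j / (N + 1)) * (v t - v u)) =
        ((i : ℝ) - j) / (N + 1) * (v t - v u) := by ring
    have h3 : (1 : ℝ) ≤ |(i : ℝ) - j| := by
      have : ((i : ℕ) : ℤ) - (j : ℕ) ≠ 0 := by
        intro h
        exact hij (Fin.ext (by omega))
      exact_mod_cast Int.one_le_abs this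
    rw [h2, abs_mul, abs_div, abs_of_pos hN0, div_mul_eq_mul_div, div_le_iff₀ hN0] at h1
    have h4 : |v t - v u| ≤ |(i : ℝ) - j| * |v t - v u| :=
      le_mul_of_one_le_left (abs_nonneg _) h3
    linarith
  omega

variable {φ : EuclideanSpace ℝ (Fin n) → ℝ} {G : Measure (EuclideanSpace ℝ (Fin n))}

theorem GradBound.abs_average_sub_average_le [SFinite G] (hG : GradBound φ G)
    (hφ : LocallyIntegrable φ) (z w : EuclideanSpace ℝ (Fin n)) {r g : ℝ} (hr : 0 < r) (hg : 0 ≤ g)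
    (hzw : ‖w - z‖ ≤ r) (hgrow : G (Metric.ball z (3 * r)) ≤ ENNReal.ofReal g) :
    |(⨍ y in Metric.ball w r, φ y) - ⨍ y in Metric.ball z r, φ y| ≤
      n * g / (r ^ n * volume.real (Metric.ball (0 : EuclideanSpace ℝ (Fin n)) 1)) * ‖w - z‖ := by
  have hω : 0 < volume.real (Metric.ball (0 : EuclideanSpace ℝ (Fin n)) 1) :=
    volumeReal_ball_pos 0 one_pos
  have h1 := hG.volume_mul_enorm_average_sub_le hφ z w (ρ := 3 * r) hr (by linarith)
  have h2 : volume.real (Metric.ball z r) *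
      |(⨍ y in Metric.ball w r, φ y) - ⨍ y in Metric.ball z r, φ y| ≤ n * ‖w - z‖ * g := by
    rw [← ENNReal.ofReal_le_ofReal_iff (by positivity), ENNReal.ofReal_mul (by positivity),
      ENNReal.ofReal_mul (by positivity), ENNReal.ofReal_mul (by positivity),
      ofReal_measureReal measure_ball_lt_top.ne, ← Real.norm_eq_abs, ofReal_norm, ofReal_norm,
      ENNReal.ofReal_natCast]
    exact h1.trans (by gcongr)
  rw [volumeReal_ball_eq z hr] at h2
  rw [div_mul_eq_mul_div, le_div_iff₀ (by positivity)]
  linarith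

/-- Chebyshev's inequality: on B(x,ρ) the kernel is at least ρ^(−(n−1+s)). -/
theorem gradVariation_ball_inter_le {s : ℝ} {U : Set (EuclideanSpace ℝ (Fin n))}
    (hU : IsOpen U) (hs : 0 ≤ (n : ℝ) - 1 + s)
    {x : EuclideanSpace ℝ (Fin n)} (hx : gradPotential φ s U x ≠ ⊤) {ρ : ℝ} (hρ : 0 < ρ) :
    gradVariation φ (Metric.ball x ρ ∩ U) ≤
      ENNReal.ofReal (ρ ^ ((n : ℝ) - 1 + s) * (gradPotential φ s U x).toReal) := by
  have hρ' : 0 < ρ ^ ((n : ℝ) - 1 + s) := Real.rpow_pos_of_pos hρ _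
  rw [ENNReal.ofReal_mul hρ'.le, ENNReal.ofReal_toReal hx]
  have h1 : ENNReal.ofReal (ρ ^ (-((n : ℝ) - 1 + s))) * gradVariation φ (Metric.ball x ρ ∩ U) ≤
      gradPotential φ s U x := by
    calc _ = ∫⁻ _y in Metric.ball x ρ ∩ U, ENNReal.ofReal (ρ ^ (-((n : ℝ) - 1 + s)))
            ∂gradVariation φ := by rw [setLIntegral_const]
      _ ≤ ∫⁻ y in Metric.ball x ρ ∩ U, ‖x - y‖ₑ ^ (-((n : ℝ) - 1 + s)) ∂gradVariation φ := by
          refine setLIntegral_mono' (Metric.isOpen_ball.inter hU).measurableSet fun y hy => ?_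
          rw [← ENNReal.ofReal_rpow_of_pos hρ, ENNReal.rpow_neg, ENNReal.rpow_neg,
            ENNReal.inv_le_inv]
          refine ENNReal.rpow_le_rpow ?_ hs
          rw [← ofReal_norm]
          refine ENNReal.ofReal_le_ofReal ?_
          have := hy.1
          rw [Metric.mem_ball', dist_eq_norm] at this
          exact this.le
      _ ≤ gradPotential φ s U x := lintegral_mono_set inter_subset_right
  calc gradVariation φ (Metric.ball x ρ ∩ U)
      = ENNReal.ofReal (ρ ^ ((n : ℝ) - 1 + s)) *
        (ENNReal.ofReal (ρ ^ (-((n : ℝ) - 1 + s))) * gradVariation φ (Metric.ball x ρ ∩ U)) := by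
        rw [← mul_assoc, ← ENNReal.ofReal_mul hρ'.le, ← Real.rpow_add hρ, add_neg_cancel,
          Real.rpow_zero, ENNReal.ofReal_one, one_mul]
    _ ≤ _ := by gcongr

set_option maxHeartbeats 800000 in
/-- The composition of a function of bounded variation with a path is controlled by the increments
of the path and the potential of the gradient measure. -/
theorem exists_enorm_comp_sub_le (n : ℕ) (hn : 1 ≤ n) {s κ : ℝ} (hs : 0 < s) (hκ : 0 < κ) :
    ∃ C : ℝ, 0 < C ∧ ∀ (a b : ℝ) (φ φt : EuclideanSpace ℝ (Fin n) → ℝ)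
      (X : ℝ → EuclideanSpace ℝ (Fin n)) (U : Set (EuclideanSpace ℝ (Fin n))),
      BVLoc φ → IsLebesgueRep φ φt → ContinuousOn X (Icc a b) → IsOpen U →
      Metric.thickening (κ * Metric.diam (X '' Icc a b)) (X '' Icc a b) ⊆ U →
      ∀ t ∈ Icc a b, ∀ u ∈ Icc a b, ‖φt (X t) - φt (X u)‖ₑ ≤
        ENNReal.ofReal C * ‖X t - X u‖ₑ ^ s *
          (gradPotential φ s U (X t) + gradPotential φ s U (X u)) := by
  -- For r ≤ δD and z on the path, 3δ ≤ κ places B(z,3r) inside U, and 3δ ≤ 1 places it inside B(X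
  -- t, 2D).
  set δ : ℝ := min κ 1 / 5 with hδ
  have hδ0 : 0 < δ := by positivity
  have hδκ : 5 * δ ≤ κ := by rw [hδ]; linarith [min_le_left κ 1]
  have hδ1 : 5 * δ ≤ 1 := by rw [hδ]; linarith [min_le_right κ 1]
  obtain ⟨N, hN⟩ := exists_card_le_of_separated_in_closedBall n hδ0
  set vB := volume.real (Metric.ball (0 : EuclideanSpace ℝ (Fin n)) 1) with h_voldef
  have h_vol : 0 < vB := volumeReal_ball_pos 0 one_pos
  set a' : ℝ := (n : ℝ) - 1 + s with ha'
  have hn1 : (1 : ℝ) ≤ n := by exact_mod_cast hn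
  have ha0 : 0 ≤ a' := by rw [ha']; linarith
  have hθ1 : (2 : ℝ) ^ (-s) < 1 := Real.rpow_lt_one_of_one_lt_of_neg one_lt_two (neg_lt_zero.2 hs)
  set C₁ : ℝ := 2 ^ n * oscConst n s / (1 - 2 ^ (-s)) with hC₁
  have hC₁0 : 0 ≤ C₁ := by
    have h1 := oscConst_nonneg n s
    have h2 : 0 < 1 - (2 : ℝ) ^ (-s) := sub_pos.2 hθ1
    positivity
  -- C₁ accounts for replacing values by averages, C₂ for a single translation, C₃ for the passage
  -- along the path. The 1 added below only secures positivity.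
  set C₂ : ℝ := n * 3 ^ a' / vB with hC₂
  set C₃ : ℝ := (N + 1) * (n * (2 / δ) ^ a' / vB) with hC₃
  have hC₂0 : 0 ≤ C₂ := by positivity
  have hC₃0 : 0 ≤ C₃ := by positivity
  refine ⟨C₁ + C₂ + C₃ + 1, by positivity, ?_⟩
  intro a b φ φt X U hBV hrep hX hU hthick t ht u hu
  by_cases hxy : X t = X u
  · simp [hxy]
  have hd : 0 < ‖X t - X u‖ := norm_pos_iff.2 (sub_ne_zero.2 hxy)
  have hcoef : ENNReal.ofReal (C₁ + C₂ + C₃ + 1) * ‖X t - X u‖ₑ ^ s ≠ 0 := by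
    refine mul_ne_zero (ENNReal.ofReal_pos.2 (by positivity)).ne' ?_
    rw [← ofReal_norm, ENNReal.ofReal_rpow_of_pos hd]
    exact (ENNReal.ofReal_pos.2 (by positivity)).ne'
  by_cases hpt : gradPotential φ s U (X t) = ⊤
  · rw [hpt, top_add, ENNReal.mul_top hcoef]; exact le_top
  by_cases hpu : gradPotential φ s U (X u) = ⊤
  · rw [hpu, add_top, ENNReal.mul_top hcoef]; exact le_top
  have hG := hBV.gradBound
  have hφ := hBV.1
  have : SigmaFinite (gradVariation φ) := hBV.sigmaFinite_gradVariation
  set G := gradVariation φ with hGdef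
  set K := X '' Icc a b with hK
  set D := Metric.diam K with hD
  have hKb : Bornology.IsBounded K := (isCompact_Icc.image_of_continuousOn hX).isBounded
  have hdK : ∀ x ∈ K, ∀ y ∈ K, dist x y ≤ D := fun x hx y hy =>
    Metric.dist_le_diam_of_mem hKb hx hy
  have htK : X t ∈ K := mem_image_of_mem X ht
  have huK : X u ∈ K := mem_image_of_mem X hu
  set d := ‖X t - X u‖ with hddef
  have hdD : d ≤ D := by rw [hddef, ← dist_eq_norm]; exact hdK _ htK _ huK
  have hD0 : 0 < D := hd.trans_le hdD
  have hballU : ∀ x ∈ K, ∀ ρ, ρ ≤ κ * D → Metric.ball x ρ ⊆ U := fun x hx ρ hρ =>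
    ((Metric.ball_subset_thickening hx ρ).trans (Metric.thickening_mono hρ K)).trans hthick
  set pt := (gradPotential φ s U (X t)).toReal with hptdef
  set pu := (gradPotential φ s U (X u)).toReal with hpudef
  have hpt0 : 0 ≤ pt := ENNReal.toReal_nonneg
  have hpu0 : 0 ≤ pu := ENNReal.toReal_nonneg
  -- the representative is close to the averages
  have hlim : ∀ x ∈ K, gradPotential φ s U x ≠ ⊤ → ∀ r, 0 < r → r ≤ δ * D →
      |(⨍ y in Metric.ball x r, φ y) - φt x| ≤ C₁ * r ^ s * (gradPotential φ s U x).toReal := by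
    intro x hx hpx r hr hrD
    obtain ⟨l, hl, hl'⟩ := hG.exists_hasApproxLimit hφ hs hr ENNReal.toReal_nonneg
      (x := x) (P := (gradPotential φ s U x).toReal) fun r' hr' hr'r => by
        have hsub : Metric.ball x (3 * r') ⊆ U := hballU x hx _ (by nlinarith)
        have := gradVariation_ball_inter_le hU ha0 hpx (ρ := 3 * r') (by positivity)
        rwa [inter_eq_left.2 hsub] at this
    rw [hrep.2 x l hl]
    exact hl'
  -- The radius is r = min(d, δD). The bound r ≤ d turns every r^s into d^s, while r ≤ δD keeps the
  -- balls inside U.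
  have key : ∃ r, 0 < r ∧ r ≤ δ * D ∧ r ≤ d ∧
      |(⨍ y in Metric.ball (X t) r, φ y) - ⨍ y in Metric.ball (X u) r, φ y| ≤
        (C₂ + C₃) * d ^ s * pt := by
    rcases le_total d (δ * D) with hcase | hcase
    · refine ⟨d, hd, hcase, le_rfl, ?_⟩
      have hsub : Metric.ball (X t) (3 * d) ⊆ U := hballU _ htK _ (by nlinarith)
      have hg := gradVariation_ball_inter_le hU ha0 hpt (ρ := 3 * d) (by positivity)
      rw [inter_eq_left.2 hsub] at hg
      have h1 := hG.abs_average_sub_average_le hφ (X t) (X u) hd (by positivity)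
        (by rw [norm_sub_rev]) hg
      rw [abs_sub_comm]
      refine h1.trans ?_
      rw [norm_sub_rev, ← hddef]
      have h2 : n * ((3 * d) ^ a' * pt) / (d ^ n * vB) * d = C₂ * d ^ s * pt := by
        rw [Real.mul_rpow (by norm_num) hd.le, hC₂]
        have := mul_rpow_sub_one_add hd n s
        rw [← ha'] at this
        field_simp
        linear_combination pt * this
      rw [h2]
      gcongr
      linarith
    · set r := δ * D with hr
      have hr0 : 0 < r := by positivity
      refine ⟨r, hr0, le_rfl, hcase, ?_⟩
      set g := (2 * D) ^ a' * pt with hgdef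
      have hg0 : 0 ≤ g := by positivity
      -- The potential is known to be finite only at the two endpoints. The mass near an
      -- intermediate z is therefore bounded through B(X t, 2D) ∩ U, whose radius is a fixed
      -- multiple of r.
      have hgrow : ∀ z ∈ K, G (Metric.ball z (3 * r)) ≤ ENNReal.ofReal g := fun z hz => by
        refine le_trans (measure_mono ?_)
          (gradVariation_ball_inter_le hU ha0 hpt (ρ := 2 * D) (by positivity))
        refine subset_inter (Metric.ball_subset_ball' ?_) (hballU z hz _ (by nlinarith))
        have := hdK z hz _ htK
        nlinarith
      set L := n * g / (r ^ n * vB) with hL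
      have hL0 : 0 ≤ L := by positivity
      have hlip : ∀ z ∈ K, ∀ w ∈ K, ‖w - z‖ ≤ r →
          |(⨍ y in Metric.ball w r, φ y) - ⨍ y in Metric.ball z r, φ y| ≤ L * ‖w - z‖ :=
        fun z hz w _ hzw => hG.abs_average_sub_average_le hφ z w hr0 hg0 hzw (hgrow z hz)
      set v : ℝ → ℝ := fun t => ⨍ y in Metric.ball (X t) r, φ y with hv
      have hvc : ContinuousOn v (Icc a b) := by
        intro t₀ ht₀
        have hXt : Tendsto (fun t => ‖X t - X t₀‖) (𝓝[Icc a b] t₀) (𝓝 0) :=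
          tendsto_iff_norm_sub_tendsto_zero.1 (hX t₀ ht₀)
        refine tendsto_iff_norm_sub_tendsto_zero.2 ?_
        refine squeeze_zero' (Eventually.of_forall fun _ => norm_nonneg _) ?_
          (by simpa using hXt.const_mul L)
        filter_upwards [self_mem_nhdsWithin, hXt.eventually (gt_mem_nhds hr0)] with t₁ ht₁ hlt
        exact hlip _ (mem_image_of_mem X ht₀) _ (mem_image_of_mem X ht₁) hlt.le
      have h1 := abs_sub_le_of_card_separated_le (X := X) (r := r) (A := L * r) (N := N) hvc
        (fun t₁ ht₁ t₂ ht₂ hle => by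
          rw [dist_eq_norm] at hle
          exact (hlip _ (mem_image_of_mem X ht₂) _ (mem_image_of_mem X ht₁) hle).trans (by gcongr))
        (fun k f hf hsep => hN (X t) D k f hD0 (fun i => hdK _ (hf i) _ htK) hsep) ht hu
      refine h1.trans ?_
      have h2 : (N + 1) * (L * r) = C₃ * r ^ s * pt := by
        have hDr : 2 * D = 2 / δ * r := by rw [hr]; field_simp
        rw [hL, hgdef, hDr, Real.mul_rpow (by positivity) hr0.le, hC₃]
        have := mul_rpow_sub_one_add hr0 n s
        rw [← ha'] at this
        clear_value r
        field_simp
        linear_combination pt * this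
      rw [h2]
      gcongr
      linarith
  obtain ⟨r, hr0, hrD, hrd, hmean⟩ := key
  have h1 := hlim _ htK hpt r hr0 hrD
  have h2 := hlim _ huK hpu r hr0 hrD
  have hrs : r ^ s ≤ d ^ s := by gcongr
  have hds : 0 ≤ d ^ s := by positivity
  have hreal : |φt (X t) - φt (X u)| ≤ (C₁ + C₂ + C₃ + 1) * d ^ s * (pt + pu) := by
    calc |φt (X t) - φt (X u)|
        ≤ |φt (X t) - ⨍ y in Metric.ball (X t) r, φ y| +
          |(⨍ y in Metric.ball (X t) r, φ y) - ⨍ y in Metric.ball (X u) r, φ y| +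
          |(⨍ y in Metric.ball (X u) r, φ y) - φt (X u)| := by
          refine (abs_sub_le _ (⨍ y in Metric.ball (X u) r, φ y) _).trans ?_
          gcongr
          exact abs_sub_le _ _ _
      _ ≤ C₁ * d ^ s * pt + (C₂ + C₃) * d ^ s * pt + C₁ * d ^ s * pu := by
          refine add_le_add (add_le_add ?_ hmean) ?_
          · rw [abs_sub_comm]; exact h1.trans (by gcongr)
          · exact h2.trans (by gcongr)
      _ ≤ _ := by
          have e1 : 0 ≤ d ^ s * pt := by positivity
          have e2 : 0 ≤ d ^ s * pu := by positivity
          have e3 : 0 ≤ (C₂ + C₃) * (d ^ s * pu) := by positivity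
          linear_combination e1 + e2 + e3
  rw [← ENNReal.ofReal_toReal hpt, ← ENNReal.ofReal_toReal hpu, ← ENNReal.ofReal_add hpt0 hpu0,
    ← ofReal_norm, ← ofReal_norm, ENNReal.ofReal_rpow_of_nonneg hd.le hs.le,
    ← ENNReal.ofReal_mul (by positivity), ← ENNReal.ofReal_mul (by positivity), Real.norm_eq_abs]
  exact ENNReal.ofReal_le_ofReal hreal

end Spatial

/-! ### Integration in time -/

section Time

variable {n : ℕ} {α T : ℝ} {X : ℝ → EuclideanSpace ℝ (Fin n)}

theorem enorm_sub_le_holderSeminorm {t u : ℝ} (ht : t ∈ Icc 0 T)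
    (hu : u ∈ Icc 0 T) : ‖X t - X u‖ₑ ≤ holderSeminorm α T X * ENNReal.ofReal (|t - u| ^ α) := by
  wlog hut : u ≤ t generalizing t u
  · rw [enorm_sub_rev, abs_sub_comm]
    exact this hu ht (le_of_not_ge hut)
  rcases hut.eq_or_lt with rfl | hut
  · simp
  have h1 : ‖X t - X u‖ₑ / ENNReal.ofReal ((t - u) ^ α) ≤ holderSeminorm α T X :=
    le_iSup_of_le u (le_iSup_of_le t (le_iSup_of_le ⟨hu.1, hut, ht.2⟩ le_rfl))
  rw [abs_of_pos (sub_pos.2 hut)]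
  refine (ENNReal.div_le_iff_le_mul (Or.inl ?_) (Or.inl ENNReal.ofReal_ne_top)).1 h1
  exact (ENNReal.ofReal_pos.2 (Real.rpow_pos_of_pos (sub_pos.2 hut) _)).ne'

theorem IsHolderPath.continuousOn (hX : IsHolderPath α T X) (hα : 0 < α) :
    ContinuousOn X (Icc 0 T) := by
  have h : HolderOnWith (holderSeminorm α T X).toNNReal α.toNNReal X (Icc 0 T) := by
    intro t ht u hu
    rw [ENNReal.coe_toNNReal hX.ne, edist_eq_enorm_sub, Real.coe_toNNReal _ hα.le, edist_dist,
      Real.dist_eq, ENNReal.ofReal_rpow_of_nonneg (abs_nonneg _) hα.le]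
    exact enorm_sub_le_holderSeminorm ht hu
  exact h.continuousOn (Real.toNNReal_pos.2 hα)

theorem measurable_gradPotential {φ : EuclideanSpace ℝ (Fin n) → ℝ}
    (hφ : BVLoc φ) (s : ℝ) (U : Set (EuclideanSpace ℝ (Fin n))) :
    Measurable (gradPotential φ s U) := by
  have := hφ.sigmaFinite_gradVariation
  refine Measurable.lintegral_prod_right' (ν := (gradVariation φ).restrict U)
    (f := fun p : EuclideanSpace ℝ (Fin n) × EuclideanSpace ℝ (Fin n) =>
      ‖p.1 - p.2‖ₑ ^ (-((n : ℝ) - 1 + s))) ?_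
  fun_prop

theorem lintegral_Ioo_rpow {γ a : ℝ} (hγ : 0 < γ) (ha : 0 ≤ a) :
    ∫⁻ w in Ioo 0 a, ENNReal.ofReal (|w| ^ (γ - 1)) = ENNReal.ofReal (a ^ γ / γ) := by
  have hint : IntervalIntegrable (fun w : ℝ => w ^ (γ - 1)) volume 0 a :=
    intervalIntegral.intervalIntegrable_rpow' (by linarith)
  rw [intervalIntegrable_iff_integrableOn_Ioo_of_le ha] at hint
  have h1 : ∫⁻ w in Ioo 0 a, ENNReal.ofReal (|w| ^ (γ - 1)) =
      ∫⁻ w in Ioo 0 a, ENNReal.ofReal (w ^ (γ - 1)) :=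
    setLIntegral_congr_fun measurableSet_Ioo fun w hw => by simp only [abs_of_pos hw.1]
  rw [h1, ← ofReal_integral_eq_lintegral_ofReal hint, ← integral_Ioc_eq_integral_Ioo,
    ← intervalIntegral.integral_of_le ha, integral_rpow (Or.inl (by linarith))]
  · rw [sub_add_cancel, Real.zero_rpow hγ.ne', sub_zero]
  · exact (ae_restrict_iff' measurableSet_Ioo).2
      (Eventually.of_forall fun w hw => Real.rpow_nonneg hw.1.le _)

/-- The difference t − u stays in (−T, T), and each half of this interval contributes T^γ/γ. -/
theorem lintegral_Ioo_abs_sub_rpow_le {γ t : ℝ} (hγ : 0 < γ) (ht : t ∈ Icc 0 T) :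
    ∫⁻ u in Ioo 0 T, ENNReal.ofReal (|t - u| ^ (γ - 1)) ≤
      ENNReal.ofReal (2 * T ^ γ / γ) := by
  have hT : 0 ≤ T := ht.1.trans ht.2
  set k : ℝ → ℝ≥0∞ := fun w => ENNReal.ofReal (|w| ^ (γ - 1)) with hk
  have hneg : ∫⁻ w in Ioo (-T) 0, k w = ∫⁻ w in Ioo 0 T, k w := by
    rw [← lintegral_indicator measurableSet_Ioo, ← lintegral_indicator measurableSet_Ioo,
      ← lintegral_neg_eq_self]
    refine lintegral_congr fun w => ?_
    have hw : -w ∈ Ioo (-T) 0 ↔ w ∈ Ioo 0 T := by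
      simp only [mem_Ioo]; constructor <;> rintro ⟨_, _⟩ <;> constructor <;> linarith
    by_cases h : w ∈ Ioo 0 T
    · rw [indicator_of_mem h, indicator_of_mem (hw.2 h)]; simp [hk]
    · rw [indicator_of_notMem h, indicator_of_notMem (fun h' => h (hw.1 h'))]
  calc ∫⁻ u in Ioo 0 T, k (t - u) ≤ ∫⁻ u, (Ioc (-T) 0 ∪ Ioo 0 T).indicator k (t - u) := by
        rw [← lintegral_indicator measurableSet_Ioo]
        refine lintegral_mono fun u => ?_
        by_cases hu : u ∈ Ioo 0 T
        · have hmem : t - u ∈ Ioc (-T) 0 ∪ Ioo 0 T := by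
            rcases le_or_gt (t - u) 0 with h | h
            · exact Or.inl ⟨by linarith [hu.2, ht.1], h⟩
            · exact Or.inr ⟨h, by linarith [hu.1, ht.2]⟩
          rw [indicator_of_mem hu, indicator_of_mem hmem]
        · rw [indicator_of_notMem hu]; exact zero_le
    _ = ∫⁻ w in Ioc (-T) 0 ∪ Ioo 0 T, k w := by
        rw [lintegral_sub_left_eq_self,
          lintegral_indicator (measurableSet_Ioc.union measurableSet_Ioo)]
    _ ≤ (∫⁻ w in Ioc (-T) 0, k w) + ∫⁻ w in Ioo 0 T, k w := lintegral_union_le _ _ _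
    _ = ENNReal.ofReal (T ^ γ / γ) + ENNReal.ofReal (T ^ γ / γ) := by
        rw [← setLIntegral_congr Ioo_ae_eq_Ioc, hneg, lintegral_Ioo_rpow hγ hT]
    _ = ENNReal.ofReal (2 * T ^ γ / γ) := by
        rw [← ENNReal.ofReal_add (by positivity) (by positivity)]
        congr 1; ring

/-- The exponent count in time: αsp − (1 + βp) = (αs − β)p − 1. -/
theorem rpow_div_ofReal_rpow_le {a C H q : ℝ≥0∞} {α β s p δ : ℝ} (hs : 0 < s) (hp : 0 < p)
    (hδ : 0 < δ) (h : a ≤ C * (H * ENNReal.ofReal (δ ^ α)) ^ s * q) :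
    a ^ p / ENNReal.ofReal (δ ^ (1 + β * p)) ≤
      C ^ p * H ^ (s * p) * q ^ p * ENNReal.ofReal (δ ^ ((α * s - β) * p - 1)) := by
  have h1 : a ^ p ≤ C ^ p * H ^ (s * p) * q ^ p * ENNReal.ofReal (δ ^ (α * s * p)) := by
    refine (ENNReal.rpow_le_rpow h hp.le).trans (le_of_eq ?_)
    rw [ENNReal.mul_rpow_of_nonneg _ _ hp.le, ENNReal.mul_rpow_of_nonneg _ _ hp.le,
      ENNReal.mul_rpow_of_nonneg _ _ hs.le, ENNReal.mul_rpow_of_nonneg _ _ hp.le,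
      ← ENNReal.rpow_mul, ENNReal.ofReal_rpow_of_pos (by positivity),
      ENNReal.ofReal_rpow_of_pos (by positivity), ← Real.rpow_mul hδ.le, ← Real.rpow_mul hδ.le]
    ring
  have h2 : ENNReal.ofReal (δ ^ (α * s * p)) / ENNReal.ofReal (δ ^ (1 + β * p)) =
      ENNReal.ofReal (δ ^ ((α * s - β) * p - 1)) := by
    rw [← ENNReal.ofReal_div_of_pos (by positivity), ← Real.rpow_sub hδ]
    congr 2; ring
  rw [← h2, ← mul_div_assoc]
  gcongr

/-- Pointwise control of the integrand of the Gagliardo seminorm. -/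
theorem exists_enorm_comp_sub_rpow_div_le (n : ℕ) (hn : 1 ≤ n) {α s κ : ℝ} (β : ℝ) (hα : 0 < α)
    (hs : 0 < s) (hκ : 0 < κ) :
    ∃ C : ℝ, 0 < C ∧ ∀ (p : ℝ) (T : ℝ) (φ φt : EuclideanSpace ℝ (Fin n) → ℝ)
      (X : ℝ → EuclideanSpace ℝ (Fin n)) (U : Set (EuclideanSpace ℝ (Fin n))), 0 < p →
      BVLoc φ → IsLebesgueRep φ φt → IsHolderPath α T X → IsOpen U →
      Metric.thickening (κ * Metric.diam (X '' Icc 0 T)) (X '' Icc 0 T) ⊆ U →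
      ∀ t ∈ Icc 0 T, ∀ u ∈ Icc 0 T,
        ‖φt (X t) - φt (X u)‖ₑ ^ p / ENNReal.ofReal (|t - u| ^ (1 + β * p)) ≤
          ENNReal.ofReal C ^ p * holderSeminorm α T X ^ (s * p) *
            (gradPotential φ s U (X t) + gradPotential φ s U (X u)) ^ p *
            ENNReal.ofReal (|t - u| ^ ((α * s - β) * p - 1)) := by
  obtain ⟨C, hC, hmain⟩ := exists_enorm_comp_sub_le n hn hs hκ
  refine ⟨C, hC, fun p T φ φt X U hp hφ hrep hX hU hthick t ht u hu => ?_⟩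
  -- On the diagonal the left side is 0, since 0 divided by anything is 0 in `ℝ≥0∞`.
  rcases eq_or_ne t u with rfl | htu
  · simp [hp]
  refine rpow_div_ofReal_rpow_le hs hp (abs_pos.2 (sub_ne_zero.2 htu)) ?_
  refine (hmain 0 T φ φt X U hφ hrep (hX.continuousOn hα) hU hthick t ht u hu).trans ?_
  gcongr
  exact enorm_sub_le_holderSeminorm ht hu

/-- The kernel is symmetric, so by Tonelli the terms with q t and q u contribute equally. -/
theorem lintegral_lintegral_add_mul_rpow_le {q : ℝ → ℝ≥0∞} {γ T : ℝ} (hγ : 0 < γ)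
    (hq : AEMeasurable q (volume.restrict (Ioo 0 T))) :
    ∫⁻ t in Ioo 0 T, ∫⁻ u in Ioo 0 T, (q t + q u) * ENNReal.ofReal (|t - u| ^ (γ - 1)) ≤
      2 * (ENNReal.ofReal (2 * T ^ γ / γ) * ∫⁻ t in Ioo 0 T, q t) := by
  set k : ℝ → ℝ → ℝ≥0∞ := fun t u => ENNReal.ofReal (|t - u| ^ (γ - 1)) with hk
  have hkm : Measurable (Function.uncurry k) := by
    simp only [hk, Function.uncurry_def]
    fun_prop
  have hkm' : ∀ t, Measurable (k t) := fun t => by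
    simp only [hk]
    fun_prop
  have hone : ∫⁻ t in Ioo 0 T, ∫⁻ u in Ioo 0 T, q t * k t u ≤
      ENNReal.ofReal (2 * T ^ γ / γ) * ∫⁻ t in Ioo 0 T, q t := by
    rw [← lintegral_const_mul' _ _ ENNReal.ofReal_ne_top]
    refine setLIntegral_mono' measurableSet_Ioo fun t ht => ?_
    rw [lintegral_const_mul _ (hkm' t), mul_comm]
    gcongr
    exact lintegral_Ioo_abs_sub_rpow_le hγ (Ioo_subset_Icc_self ht)
  have hswap : ∫⁻ t in Ioo 0 T, ∫⁻ u in Ioo 0 T, q u * k t u =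
      ∫⁻ t in Ioo 0 T, ∫⁻ u in Ioo 0 T, q t * k t u := by
    rw [lintegral_lintegral_swap]
    · refine lintegral_congr fun t => lintegral_congr fun u => ?_
      simp only [hk, abs_sub_comm]
    · exact (hq.comp_snd).mul hkm.aemeasurable
  calc ∫⁻ t in Ioo 0 T, ∫⁻ u in Ioo 0 T, (q t + q u) * k t u
      = ∫⁻ t in Ioo 0 T, ((∫⁻ u in Ioo 0 T, q t * k t u) + ∫⁻ u in Ioo 0 T, q u * k t u) := by
        refine lintegral_congr fun t => ?_
        rw [← lintegral_add_left ((hkm' t).const_mul _)]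
        simp_rw [add_mul]
    _ = (∫⁻ t in Ioo 0 T, ∫⁻ u in Ioo 0 T, q t * k t u) +
          ∫⁻ t in Ioo 0 T, ∫⁻ u in Ioo 0 T, q u * k t u := by
        refine lintegral_add_left' ?_ _
        have : ∀ t, ∫⁻ u in Ioo 0 T, q t * k t u = q t * ∫⁻ u in Ioo 0 T, k t u := fun t =>
          lintegral_const_mul _ (hkm' t)
        simp_rw [this]
        exact hq.mul hkm.lintegral_prod_right.aemeasurable
    _ ≤ _ := by
        rw [hswap, two_mul]
        gcongr

end Time

theorem propositionP (n : ℕ) (hn : 1 ≤ n) (α β s κ : ℝ) (hα : 0 < α) (hα' : α ≤ 1)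
    (hs : 0 < s) (hs' : s < 1) (hβ : 0 < β) (hβ' : β < α * s) (hκ : 0 < κ) :
    (∀ p : ℝ, 1 ≤ p → ∃ c : ℝ, 0 < c ∧
      ∀ (T : ℝ) (φ φt : EuclideanSpace ℝ (Fin n) → ℝ) (X : ℝ → EuclideanSpace ℝ (Fin n))
        (U : Set (EuclideanSpace ℝ (Fin n))),
        0 < T → BVLoc φ → IsLebesgueRep φ φt → IsHolderPath α T X →
        IsVariable φ s (ENNReal.ofReal p) T X →
        IsRelCompactOpenNhd U (X '' Icc 0 T) →
        Metric.thickening (κ * Metric.diam (X '' Icc 0 T)) (X '' Icc 0 T) ⊆ U →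
        gagliardoSeminorm β p T (fun t => φt (X t)) ^ p ≤
          ENNReal.ofReal (c * T ^ ((α * s - β) * p)) * holderSeminorm α T X ^ (s * p) *
            ∫⁻ t in Icc 0 T, gradPotential φ s U (X t) ^ p) ∧
    (∃ c : ℝ, 0 < c ∧
      ∀ (T : ℝ) (φ φt : EuclideanSpace ℝ (Fin n) → ℝ) (X : ℝ → EuclideanSpace ℝ (Fin n))
        (U : Set (EuclideanSpace ℝ (Fin n))),
        0 < T → BVLoc φ → IsLebesgueRep φ φt → IsHolderPath α T X →
        IsVariable φ s ⊤ T X →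
        IsRelCompactOpenNhd U (X '' Icc 0 T) →
        Metric.thickening (κ * Metric.diam (X '' Icc 0 T)) (X '' Icc 0 T) ⊆ U →
        essSup (fun t => ∫⁻ τ in Ioo 0 t,
            ‖φt (X t) - φt (X τ)‖ₑ / ENNReal.ofReal ((t - τ) ^ (1 + β)))
            (volume.restrict (Icc 0 T)) ≤
          ENNReal.ofReal (c * T ^ (α * s - β)) * holderSeminorm α T X ^ s *
            essSup (fun t => gradPotential φ s U (X t)) (volume.restrict (Icc 0 T))) := by
  obtain ⟨C, hC, hmain⟩ := exists_enorm_comp_sub_rpow_div_le n hn β hα hs hκ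
  have hγ₁ : 0 < α * s - β := sub_pos.2 hβ'
  refine ⟨fun p hp => ?_, ?_⟩
  · have hp0 : 0 < p := one_pos.trans_le hp
    set γ := (α * s - β) * p with hγdef
    have hγ : 0 < γ := mul_pos hγ₁ hp0
    -- 2^(p−1) comes from (a + b)^p ≤ 2^(p−1)(a^p + b^p), one factor 2 from the two symmetric terms,
    -- and 2/γ from the integral of the kernel.
    refine ⟨C ^ p * 2 ^ (p - 1) * (2 * (2 / γ)), by positivity, ?_⟩
    intro T φ φt X U hT hφ hrep hX _ hU hthick
    set Q : ℝ → ℝ≥0∞ := fun t => gradPotential φ s U (X t) with hQ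
    set H := holderSeminorm α T X with hH
    have hQm : AEMeasurable Q (volume.restrict (Ioo 0 T)) :=
      (measurable_gradPotential hφ s U).comp_aemeasurable
        (((hX.continuousOn hα).mono Ioo_subset_Icc_self).aemeasurable measurableSet_Ioo)
    set A : ℝ≥0∞ := ENNReal.ofReal C ^ p * H ^ (s * p) * 2 ^ (p - 1) with hA
    -- A finite constant can be taken out of the integrals without any measurability of the
    -- integrand.
    have hA' : A ≠ ⊤ := by
      refine ENNReal.mul_ne_top (ENNReal.mul_ne_top ?_ ?_) ?_
      · exact ENNReal.rpow_ne_top_of_nonneg hp0.le ENNReal.ofReal_ne_top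
      · exact ENNReal.rpow_ne_top_of_nonneg (by positivity) hX.ne
      · exact ENNReal.rpow_ne_top_of_nonneg (by linarith) (by simp)
    calc gagliardoSeminorm β p T (fun t => φt (X t)) ^ p
        = ∫⁻ t in Ioo 0 T, ∫⁻ u in Ioo 0 T,
            ‖φt (X t) - φt (X u)‖ₑ ^ p / ENNReal.ofReal (|t - u| ^ (1 + β * p)) := by
          rw [gagliardoSeminorm, ← ENNReal.rpow_mul, one_div_mul_cancel hp0.ne', ENNReal.rpow_one]
      _ ≤ ∫⁻ t in Ioo 0 T, ∫⁻ u in Ioo 0 T,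
            A * ((Q t ^ p + Q u ^ p) * ENNReal.ofReal (|t - u| ^ (γ - 1))) := by
          refine setLIntegral_mono' measurableSet_Ioo fun t ht =>
            setLIntegral_mono' measurableSet_Ioo fun u hu => ?_
          refine (hmain p T φ φt X U hp0 hφ hrep hX hU.1 hthick t (Ioo_subset_Icc_self ht) u
            (Ioo_subset_Icc_self hu)).trans ?_
          have h1 : A * ((Q t ^ p + Q u ^ p) * ENNReal.ofReal (|t - u| ^ (γ - 1))) =
              ENNReal.ofReal C ^ p * H ^ (s * p) * (2 ^ (p - 1) * (Q t ^ p + Q u ^ p)) *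
                ENNReal.ofReal (|t - u| ^ (γ - 1)) := by rw [hA]; ring
          rw [h1]
          gcongr
          exact ENNReal.rpow_add_le_mul_rpow_add_rpow _ _ hp
      _ = A * ∫⁻ t in Ioo 0 T, ∫⁻ u in Ioo 0 T,
            (Q t ^ p + Q u ^ p) * ENNReal.ofReal (|t - u| ^ (γ - 1)) := by
          rw [← lintegral_const_mul' _ _ hA']
          refine lintegral_congr fun t => ?_
          rw [lintegral_const_mul' _ _ hA']
      _ ≤ A * (2 * (ENNReal.ofReal (2 * T ^ γ / γ) * ∫⁻ t in Ioo 0 T, Q t ^ p)) := by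
          gcongr
          exact lintegral_lintegral_add_mul_rpow_le hγ (hQm.pow_const p)
      _ ≤ A * (2 * (ENNReal.ofReal (2 * T ^ γ / γ) * ∫⁻ t in Icc 0 T, Q t ^ p)) := by
          gcongr
          exact Ioo_subset_Icc_self
      _ = _ := by
          have h1 : C ^ p * 2 ^ (p - 1) * (2 * (2 / γ)) * T ^ γ =
              C ^ p * 2 ^ (p - 1) * 2 * (2 * T ^ γ / γ) := by ring
          rw [hA, h1, ENNReal.ofReal_mul (by positivity), ENNReal.ofReal_mul (by positivity),
            ENNReal.ofReal_mul (by positivity), ← ENNReal.ofReal_rpow_of_pos hC,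
            ← ENNReal.ofReal_rpow_of_pos two_pos, ENNReal.ofReal_ofNat]
          ring
  · set γ := α * s - β with hγdef
    refine ⟨C * (2 * (2 / γ)), by positivity, ?_⟩
    intro T φ φt X U hT hφ hrep hX _ hU hthick
    set Q : ℝ → ℝ≥0∞ := fun t => gradPotential φ s U (X t) with hQ
    set H := holderSeminorm α T X with hH
    set M := essSup Q (volume.restrict (Icc 0 T)) with hM
    have hQM : ∀ᵐ t ∂(volume.restrict (Icc 0 T)), Q t ≤ M := ae_le_essSup
    refine essSup_le_of_ae_le _ ?_
    filter_upwards [hQM, ae_restrict_mem measurableSet_Icc] with t htM ht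
    have hsub : Ioo 0 t ⊆ Icc 0 T := fun u hu => ⟨hu.1.le, hu.2.le.trans ht.2⟩
    calc ∫⁻ τ in Ioo 0 t, ‖φt (X t) - φt (X τ)‖ₑ / ENNReal.ofReal ((t - τ) ^ (1 + β))
        ≤ ∫⁻ τ in Ioo 0 t, ENNReal.ofReal C * H ^ s * (M + M) *
            ENNReal.ofReal (|t - τ| ^ (γ - 1)) := by
          refine lintegral_mono_ae ?_
          filter_upwards [ae_restrict_of_ae_restrict_of_subset hsub hQM,
            ae_restrict_mem measurableSet_Ioo] with τ hτM hτ
          -- The pointwise bound with p = 1. For almost all t and τ both potentials are at most M,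
          -- hence the factor M + M.
          have := hmain 1 T φ φt X U one_pos hφ hrep hX hU.1 hthick t ht τ (hsub hτ)
          simp only [ENNReal.rpow_one, mul_one] at this
          rw [← abs_of_pos (sub_pos.2 hτ.2), abs_abs]
          refine this.trans ?_
          gcongr
      _ = ENNReal.ofReal C * H ^ s * (M + M) *
            ∫⁻ τ in Ioo 0 t, ENNReal.ofReal (|t - τ| ^ (γ - 1)) :=
          lintegral_const_mul _ (by fun_prop)
      _ ≤ ENNReal.ofReal C * H ^ s * (M + M) * ENNReal.ofReal (2 * T ^ γ / γ) := by
          gcongr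
          refine (lintegral_mono_set (Ioo_subset_Ioo_right ht.2)).trans ?_
          exact lintegral_Ioo_abs_sub_rpow_le hγ₁ ht
      _ = _ := by
          have h1 : C * (2 * (2 / γ)) * T ^ γ = C * 2 * (2 * T ^ γ / γ) := by ring
          rw [h1, ENNReal.ofReal_mul (by positivity), ENNReal.ofReal_mul (by positivity),
            ENNReal.ofReal_ofNat, ← two_mul]
          ring
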